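/- Let $k$ be a field of prime characteristic $p$ and let $R = k[[x^3, x^2y, y^3, y^2z, z^3, z^2x]] \subseteq k[[x,y,z]]$, that is, the ring of all power series in these six monomials; let $\mathfrak m$ be its maximal ideal. For a Noetherian local ring $(A,\mathfrak m_A)$ of dimension $d$ write $\mathrm{e}(A) = \lim_{n\to\infty} d!\,\ell_A(A/\mathfrak m_A^n)/n^d$ for its multiplicity and, if $A$ has characteristic $p$, $\mathrm{e_{HK}}(A) = \lim_{i\to\infty} \ell_A(A/\mathfrak m_A^{[p^i]})/p^{id}$ for its Hilbert--Kunz multiplicity, where $\mathfrak m_A^{[p^i]}$ is the ideal generated by the $p^i$-th powers of the elements of $\mathfrak m_A$. Then $R$ is a Noetherian local ring with system of parameters $x^3, y^3, z^3$ (so $\dim R = 3$), and: 1. $\mathrm{e_{HK}}(R/(x^3,y^3)) = \mathrm{e}(R/(x^3,y^3)) = 11$. 2. For every integer $n \ge 1$ with $n \not\equiv 1 \pmod 3$, the ideal $J_n = (x^3, y^3+z^{3n})$ satisfies $\mathrm{e_{HK}}(R/J_n) = \mathrm{e}(R/J_n) \ne 11$, and this common value is an integer. 3. Neither multiplicity is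 continuous at $(x^3,y^3)$ in the $\mathfrak m$-adic topology: there is $\delta > 0$ such that for every $N$ there are $\varepsilon_1,\varepsilon_2\in\mathfrak m^N$ with $\mathrm{e_{HK}}(R/(x^3+\varepsilon_1,y^3+\varepsilon_2)) = \mathrm{e}(R/(x^3+\varepsilon_1,y^3+\varepsilon_2))$ and this common value differs from $11$ by at least $\delta$. -/

import Mathlib

namespace HilbertKunzExample

open Filter Topology

noncomputable section

section Multiplicities

variable (A : Type*) [CommRing A]

/-- The bracket power `I^[q]`: the ideal generated by the `q`-th powers of the elements of `I`. -/
def bracketPower {A : Type*} [CommRing A] (I : Ideal A) (q : ℕ) : Ideal A :=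
  Ideal.span ((fun a : A => a ^ q) '' (I : Set A))

/-- `A` is a Noetherian local ring and its (Hilbert-Samuel) multiplicity
`e(A) = lim d! * length (A / m ^ n) / n ^ d`, where `d = dim A`, is `e`.
(All the lengths here are finite because `A` is Noetherian local, so `toNat` loses nothing.) -/
def HasMultiplicity (e : ℝ) : Prop :=
  IsNoetherianRing A ∧ ∃ (_ : IsLocalRing A) (d : ℕ), ringKrullDim A = d ∧
    Tendsto (fun n : ℕ => (d.factorial : ℝ) *
        ((Module.length A (A ⧸ IsLocalRing.maximalIdeal A ^ n)).toNat : ℝ) / (n : ℝ) ^ d)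
      atTop (𝓝 e)

/-- `A` is a Noetherian local ring (used for `A` of prime characteristic `p`) and its
Hilbert-Kunz multiplicity `e_HK(A) = lim length (A / m^[p ^ i]) / p ^ (i * d)`,
where `d = dim A`, is `e`. (All the lengths here are finite because `A` is Noetherian local.) -/
def HasHilbertKunzMultiplicity (p : ℕ) (e : ℝ) : Prop :=
  IsNoetherianRing A ∧ ∃ (_ : IsLocalRing A) (d : ℕ), ringKrullDim A = d ∧
    Tendsto (fun i : ℕ =>
        ((Module.length A
          (A ⧸ bracketPower (IsLocalRing.maximalIdeal A) (p ^ i))).toNat : ℝ) / (p : ℝ) ^ (i * d))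
      atTop (𝓝 e)

/-- `A` is a Noetherian local ring of dimension `d` and `x 0, …, x (d - 1)` generate an ideal
primary to the maximal ideal. -/
def IsSystemOfParameters {A : Type*} [CommRing A] {d : ℕ} (x : Fin d → A) : Prop :=
  IsNoetherianRing A ∧ ∃ _ : IsLocalRing A, ringKrullDim A = d ∧
    (Ideal.span (Set.range x)).radical = IsLocalRing.maximalIdeal A

end Multiplicities

section Ring

variable (K : Type*) [Field K]

/-- The monomials `x³, x²y, y³, y²z, z³, z²x` in `K⟦x, y, z⟧`; here `x, y, z` are the variables
with index `0, 1, 2`. -/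
def gens : Fin 6 → MvPowerSeries (Fin 3) K :=
  ![MvPowerSeries.X 0 ^ 3, MvPowerSeries.X 0 ^ 2 * MvPowerSeries.X 1,
    MvPowerSeries.X 1 ^ 3, MvPowerSeries.X 1 ^ 2 * MvPowerSeries.X 2,
    MvPowerSeries.X 2 ^ 3, MvPowerSeries.X 2 ^ 2 * MvPowerSeries.X 0]

theorem hasSubst_gens : MvPowerSeries.HasSubst (gens K) := by
  apply MvPowerSeries.hasSubst_of_constantCoeff_zero
  intro i
  fin_cases i <;> simp [gens]

/-- The subring `R = K⟦x³, x²y, y³, y²z, z³, z²x⟧` of `K⟦x, y, z⟧`: all the power series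
`g(x³, x²y, y³, y²z, z³, z²x)` with `g` a power series in six variables over `K`. -/
def R : Subalgebra K (MvPowerSeries (Fin 3) K) :=
  (MvPowerSeries.substAlgHom (R := K) (hasSubst_gens K)).range

theorem gens_mem (i : Fin 6) : gens K i ∈ R K :=
  ⟨MvPowerSeries.X i, MvPowerSeries.substAlgHom_X (hasSubst_gens K) i⟩

instance : IsLocalRing (R K) :=
  IsLocalRing.of_surjective'
    (MvPowerSeries.substAlgHom (R := K) (hasSubst_gens K)).rangeRestrict.toRingHom
    (AlgHom.rangeRestrict_surjective _)

/-- `x³` as an element of `R`. -/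
def x3 : R K := ⟨MvPowerSeries.X 0 ^ 3, gens_mem K 0⟩

/-- `y³` as an element of `R`. -/
def y3 : R K := ⟨MvPowerSeries.X 1 ^ 3, gens_mem K 2⟩

/-- `z³` as an element of `R`. -/
def z3 : R K := ⟨MvPowerSeries.X 2 ^ 3, gens_mem K 4⟩

/-- The ideal `J_n = (x³, y³ + z³ⁿ)` of `R`. -/
def J (n : ℕ) : Ideal (R K) := Ideal.span {x3 K, y3 K + z3 K ^ n}

end Ring

end

end HilbertKunzExample

namespace HilbertKunzExample

open Filter Topology

/-! ### Lengths and multiplicities of one-dimensional local rings -/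

section OneDimensional

/-! Let `V` be the third Veronese subring of `K⟦x, y, z⟧`. It is free of rank 9 over `K⟦x³, y³, z³⟧`
on monomials, and `R` is `V` with certain monomials removed (`mem_R_iff`). Up to finite length, `V /
R` consists of columns of monomials along the coordinate axes. Two of them run along `z`: the
monomials `y z^(3k+2)` and `x y z^(3k+1)`.

Both `x³` and `y³` carry these two columns into `R`, up to finitely many monomials. In `R / (x³,
y³)` the multiples of a missing column by `x³` and by `y³` therefore survive as two independent
columns, since the quotient that would kill them is not in `R`. Two of the nine columns are thus
replaced by four, and the rank over `K⟦z³⟧` is `9 - 2 + 4 = 11`. By contrast, `y³ + z³ⁿ` acts on the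
missing columns as `z³ⁿ`, up to finite length, so passing from `V` to `R` changes the quotient by
finite length only and the rank remains 9. Letting `n` grow gives the discontinuity.

The quotients are one-dimensional with parameter `t = z³`, and both `m ^ k` and `m^[k]` lie between
`(t ^ k)` and `(t ^ (k - c))`. Hence both multiplicities equal `e` once the length modulo `t ^ k` is
`e * k + O(1)` (`hasMultiplicity_and_hasHilbertKunzMultiplicity_of_length`). The lower bound comes
from a dual system of functionals (`le_length_of_dual`), the upper bound from generators of a
submodule containing a multiple of everything (`length_le_of_generators`). Both reduce to
combinatorics of exponents through `exists_eq_sum_add_of_supportedIn`. -/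

theorem IsFiniteLength.length_eq_length_of_residue {K A : Type*} [Field K] [CommRing A] [Algebra K A]
    [IsLocalRing A]
    (hres : ∀ a : A, ∃ k : K, a - algebraMap K A k ∈ IsLocalRing.maximalIdeal A)
    {M : Type*} [AddCommGroup M] [Module A M] (hfin : IsFiniteLength A M) :
    ∀ [Module K M] [IsScalarTower K A M], Module.length A M = Module.length K M := by
  induction hfin with
  | of_subsingleton => intros; simp only [Module.length_eq_zero]
  | @of_simple_quotient M _ _ N hN _ ih =>
    intro _ _
    have hA := Module.length_eq_add_of_exact N.subtype N.mkQ N.subtype_injective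
      N.mkQ_surjective (LinearMap.exact_subtype_mkQ N)
    have hK := Module.length_eq_add_of_exact (R := K)
      (N.subtype.restrictScalars K) (N.mkQ.restrictScalars K) N.subtype_injective
      N.mkQ_surjective (LinearMap.exact_subtype_mkQ N)
    rw [hA, hK, ih, Module.length_eq_one A (M ⧸ N)]
    congr 1
    have : Nontrivial (M ⧸ N) := IsSimpleModule.nontrivial A (M ⧸ N)
    -- The maximal ideal annihilates a simple module, so each ring element acts through its scalar
    -- residue, and a simple module over `A` is already simple over `K`.
    have hspan : ∀ x y : M ⧸ N, x ≠ 0 → ∃ k : K, k • x = y := by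
      intro x y hx
      obtain ⟨a, rfl⟩ := IsSimpleModule.toSpanSingleton_surjective A hx y
      obtain ⟨k, hk⟩ := hres a
      refine ⟨k, ?_⟩
      have h0 : (a - algebraMap K A k) • x = 0 := by
        have hann : Module.annihilator A (M ⧸ N) = IsLocalRing.maximalIdeal A :=
          IsLocalRing.eq_maximalIdeal
            (IsSimpleModule.annihilator_isMaximal (R := A) (M := M ⧸ N))
        rw [← hann] at hk
        exact Module.mem_annihilator.mp hk x
      rw [sub_smul, algebraMap_smul, sub_eq_zero] at h0
      simpa using h0.symm
    rw [eq_comm, Module.length_eq_one_iff]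
    exact isSimpleModule_iff_toSpanSingleton_surjective.mpr
      ⟨inferInstance, fun z hz y => hspan z y hz⟩

/-- If every element of a local `K`-algebra is congruent to a scalar modulo the maximal ideal, then
lengths are dimensions over `K`. -/
theorem length_eq_length_of_residue {K A : Type*} [Field K] [CommRing A] [Algebra K A]
    [IsLocalRing A]
    (hres : ∀ a : A, ∃ k : K, a - algebraMap K A k ∈ IsLocalRing.maximalIdeal A)
    (M : Type*) [AddCommGroup M] [Module A M] [Module K M] [IsScalarTower K A M] :
    Module.length A M = Module.length K M := by
  by_cases hfin : IsFiniteLength A M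
  · exact IsFiniteLength.length_eq_length_of_residue hres hfin
  · have h1 : Module.length A M = ⊤ := by
      by_contra h
      exact hfin (Module.length_ne_top_iff.mp h)
    have h2 : Module.length A M ≤ Module.length K M := by
      have := Submodule.length_le_length_restrictScalars K (⊤ : Submodule A M)
      rwa [Module.length_top, Submodule.restrictScalars_top, Module.length_top] at this
    rw [h1, top_le_iff] at *
    exact h2.symm

theorem tendsto_div_of_abs_sub_le {u : ℕ → ℝ} {e C : ℝ} (h : ∀ n : ℕ, |u n - e * n| ≤ C) :
    Tendsto (fun n : ℕ => u n / n) atTop (𝓝 e) := by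
  rw [tendsto_iff_norm_sub_tendsto_zero]
  refine squeeze_zero' (Eventually.of_forall fun _ => norm_nonneg _) ?_
    (tendsto_const_div_atTop_nhds_zero_nat C)
  filter_upwards [eventually_gt_atTop 0] with n hn
  have hn' : (0 : ℝ) < n := by exact_mod_cast hn
  rw [Real.norm_eq_abs, show u n / n - e = (u n - e * n) / n by field_simp, abs_div,
    abs_of_pos hn']
  exact div_le_div_of_nonneg_right (h n) hn'.le

theorem abs_toNat_sub_le {l : ℕ∞} {e k D : ℕ} (h1 : ((e * k : ℕ) : ℕ∞) ≤ l + D)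
    (h2 : l ≤ ((e * k + D : ℕ) : ℕ∞)) : |(l.toNat : ℝ) - e * k| ≤ D := by
  lift l to ℕ using ne_top_of_le_ne_top (ENat.natCast_ne_top _) h2
  have h1' : e * k ≤ l + D := by exact_mod_cast h1
  have h2' : l ≤ e * k + D := by exact_mod_cast h2
  rw [ENat.toNat_natCast, abs_le]
  constructor
  · have : ((e * k : ℕ) : ℝ) ≤ ((l + D : ℕ) : ℝ) := by exact_mod_cast h1'
    push_cast at this
    linarith
  · have : ((l : ℕ) : ℝ) ≤ ((e * k + D : ℕ) : ℝ) := by exact_mod_cast h2'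
    push_cast at this
    linarith

variable {A : Type*} [CommRing A]

theorem length_quotient_le_of_le {I J : Ideal A} (h : I ≤ J) :
    Module.length A (A ⧸ J) ≤ Module.length A (A ⧸ I) :=
  Module.length_le_of_surjective (Submodule.factor h) (Submodule.factor_surjective h)

variable [IsNoetherianRing A] [IsLocalRing A] {t : A} {c C e : ℕ}

/-- The maximal ideal is minimal over `(t)`, so Krull's principal ideal theorem bounds its height by
1. A non-nilpotent `t` avoids some prime, which then lies strictly below the maximal ideal. -/
theorem ringKrullDim_eq_one_of_not_isNilpotent (ht : t ∈ IsLocalRing.maximalIdeal A)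
    (hpow : ∀ k, IsLocalRing.maximalIdeal A ^ (k + c) ≤ Ideal.span {t ^ k})
    (hnil : ¬ IsNilpotent t) : ringKrullDim A = 1 := by
  apply le_antisymm
  · rw [← IsLocalRing.maximalIdeal_height_eq_ringKrullDim]
    have hmin : IsLocalRing.maximalIdeal A ∈ (Ideal.span {t}).minimalPrimes := by
      refine ⟨⟨inferInstance, by simpa [Ideal.span_le] using ht⟩, fun q hq _ => ?_⟩
      have h1 : IsLocalRing.maximalIdeal A ^ (1 + c) ≤ q :=
        ((hpow 1).trans (by rw [pow_one])).trans hq.2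
      have := hq.1
      exact Ideal.IsPrime.le_of_pow_le h1
    have := Ideal.height_le_one_of_isPrincipal_of_mem_minimalPrimes _ _ hmin
    exact_mod_cast this
  · have : ∃ q : Ideal A, q.IsPrime ∧ t ∉ q := by
      by_contra! h
      exact hnil (mem_nilradical.mp (by rw [nilradical_eq_sInf]; simpa using fun q hq => h q hq))
    obtain ⟨q, hq, htq⟩ := this
    have hlt : (⟨q, hq⟩ : PrimeSpectrum A) < ⟨IsLocalRing.maximalIdeal A, inferInstance⟩ := by
      rw [← PrimeSpectrum.asIdeal_lt_asIdeal]
      exact lt_of_le_of_ne (IsLocalRing.le_maximalIdeal hq.ne_top) fun h => htq (show t ∈ q from (show q = _ from h) ▸ ht)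
    exact Order.one_le_krullDim_iff.mpr ⟨_, _, hlt⟩

/-- Any ideal squeezed between `(t ^ k)` and `m ^ k` has colength `e * k` up to a constant
independent of `k`; ordinary and bracket powers are two instances, so the two limits agree. -/
theorem hasMultiplicity_and_hasHilbertKunzMultiplicity_of_length
    (ht : t ∈ IsLocalRing.maximalIdeal A)
    (hpow : ∀ k, IsLocalRing.maximalIdeal A ^ (k + c) ≤ Ideal.span {t ^ k})
    (he : 1 ≤ e)
    (hlow : ∀ k : ℕ, ((e * k : ℕ) : ℕ∞) ≤ Module.length A (A ⧸ Ideal.span {t ^ k}) + C)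
    (hupp : ∀ k : ℕ, Module.length A (A ⧸ Ideal.span {t ^ k}) ≤ ((e * k + C : ℕ) : ℕ∞))
    {p : ℕ} (hp : 1 < p) :
    HasHilbertKunzMultiplicity A p e ∧ HasMultiplicity A e := by
  have hdim : ringKrullDim A = (1 : ℕ) := by
    refine ringKrullDim_eq_one_of_not_isNilpotent ht hpow ?_
    rintro ⟨k, hk⟩
    -- If `t ^ k = 0`, the colength of `(t ^ k')` stays at that of `(t ^ k)`; this `k'` is large
    -- enough for the lower bound to exceed the upper bound at `k`.
    set k' := k + (e * k + C + C + 1)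
    have h1 := hupp k
    have h2 := hlow k'
    rw [show t ^ k' = 0 by rw [pow_add, hk, zero_mul], ← hk] at h2
    have h3 : ((e * k' : ℕ) : ℕ∞) ≤ ((e * k + C : ℕ) : ℕ∞) + C := h2.trans (by gcongr)
    have h4 : e * k' ≤ e * k + C + C := by exact_mod_cast h3
    have h5 : e * k + C + C + 1 ≤ e * k' := by
      calc e * k + C + C + 1 ≤ 1 * k' := by omega
        _ ≤ e * k' := Nat.mul_le_mul_right _ he
    omega
  have key : ∀ (I : Ideal A) (k : ℕ), t ^ k ∈ I → I ≤ IsLocalRing.maximalIdeal A ^ k →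
      |((Module.length A (A ⧸ I)).toNat : ℝ) - e * k| ≤ ((C + e * c : ℕ) : ℝ) := by
    intro I k h1 h2
    have hI : I ≤ Ideal.span {t ^ (k - c)} := by
      rcases le_total c k with h | h
      · refine h2.trans ?_
        have := hpow (k - c)
        rwa [Nat.sub_add_cancel h] at this
      · rw [Nat.sub_eq_zero_of_le h]; simp
    have hI' : Ideal.span {t ^ k} ≤ I := by simpa [Ideal.span_le] using h1
    apply abs_toNat_sub_le
    · have h3 := (hlow (k - c)).trans (add_le_add_left (length_quotient_le_of_le hI) _)
      have h4 : e * k ≤ e * (k - c) + e * c := by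
        rw [← mul_add]; exact Nat.mul_le_mul_left _ (by omega)
      calc ((e * k : ℕ) : ℕ∞) ≤ ((e * (k - c) + e * c : ℕ) : ℕ∞) := by exact_mod_cast h4
        _ = ((e * (k - c) : ℕ) : ℕ∞) + (e * c : ℕ) := by push_cast; rfl
        _ ≤ (Module.length A (A ⧸ I) + C) + (e * c : ℕ) := by gcongr
        _ = _ := by push_cast; rw [add_assoc]
    · refine (length_quotient_le_of_le hI').trans ((hupp k).trans ?_)
      exact_mod_cast (by omega : e * k + C ≤ e * k + (C + e * c))
  constructor
  · refine ⟨inferInstance, inferInstance, 1, hdim, ?_⟩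
    have h := tendsto_div_of_abs_sub_le (fun k => key
      (bracketPower (IsLocalRing.maximalIdeal A) k) k
      (Ideal.subset_span ⟨t, ht, rfl⟩) (Ideal.span_le.mpr (by
        rintro _ ⟨a, ha, rfl⟩
        exact Ideal.pow_mem_pow ha k)))
    have h' := h.comp (tendsto_pow_atTop_atTop_of_one_lt hp)
    refine h'.congr fun i => ?_
    simp
  · refine ⟨inferInstance, inferInstance, 1, hdim, ?_⟩
    have h := tendsto_div_of_abs_sub_le (fun k => key
      (IsLocalRing.maximalIdeal A ^ k) k (Ideal.pow_mem_pow ht k) le_rfl)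
    refine h.congr fun i => ?_
    simp

end OneDimensional

/-! ### Bounds for the length of `R / (J + (t ^ m))` -/

section Bounds

variable {K B : Type*} [Field K] [CommRing B] [Algebra K B] {J : Ideal B} {t : B}

theorem mk_mk_eq_zero_iff {m : ℕ} {f : B} :
    Ideal.Quotient.mk (Ideal.span {Ideal.Quotient.mk J t ^ m}) (Ideal.Quotient.mk J f) = 0 ↔
      ∃ g, f - t ^ m * g ∈ J := by
  rw [Ideal.Quotient.eq_zero_iff_mem, Ideal.mem_span_singleton']
  constructor
  · rintro ⟨a, ha⟩
    obtain ⟨g, rfl⟩ := Ideal.Quotient.mk_surjective a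
    refine ⟨g, ?_⟩
    rw [← Ideal.Quotient.eq_zero_iff_mem, map_sub, map_mul, map_pow, ← ha]
    ring
  · rintro ⟨g, hg⟩
    rw [← Ideal.Quotient.eq_zero_iff_mem, map_sub, map_mul, map_pow] at hg
    exact ⟨Ideal.Quotient.mk J g, by linear_combination -hg⟩

/-- The functionals with index below `k` factor through the quotient, and on the elements `t ^ i * b
r` they form an identity matrix. This gives `e * (k - c)` independent elements; the summand `e * c`
also absorbs the truncated subtraction when `k < c`. -/
theorem le_length_of_dual {e c : ℕ} (lam : Fin e → ℕ → B →ₗ[K] K) (b : Fin e → B)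
    (hJ : ∀ r l, ∀ f ∈ J, lam r l f = 0)
    (ht : ∀ r l m f, l < m → lam r l (t ^ m * f) = 0)
    (hb : ∀ r r' i l, lam r' (c + l) (t ^ i * b r) = if r = r' ∧ i = l then 1 else 0) (k : ℕ) :
    ((e * k : ℕ) : ℕ∞) ≤ Module.length K
      ((B ⧸ J) ⧸ Ideal.span {Ideal.Quotient.mk J t ^ k}) + (e * c : ℕ) := by
  set Q := (B ⧸ J) ⧸ Ideal.span {Ideal.Quotient.mk J t ^ k}
  let q : B →ₗ[K] Q := ((Ideal.Quotient.mkₐ K _).comp (Ideal.Quotient.mkₐ K J)).toLinearMap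
  have hq : Function.Surjective q :=
    (Ideal.Quotient.mk_surjective).comp (Ideal.Quotient.mk_surjective)
  let Lam : B →ₗ[K] (Fin e × Fin (k - c) → K) := LinearMap.pi fun x => lam x.1 (c + x.2)
  have hker : LinearMap.ker q ≤ LinearMap.ker Lam := by
    intro f hf
    obtain ⟨g, hg⟩ := mk_mk_eq_zero_iff.mp (LinearMap.mem_ker.mp hf)
    rw [LinearMap.mem_ker]
    ext ⟨r, l⟩
    have h1 := hJ r (c + l) _ hg
    rw [map_sub, ht _ _ _ _ (by omega), sub_zero] at h1
    exact h1
  have hLam : Function.Surjective Lam := by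
    intro v
    refine ⟨∑ x, v x • (t ^ (x.2 : ℕ) * b x.1), ?_⟩
    ext ⟨r, l⟩
    simp only [Lam, LinearMap.pi_apply, map_sum, map_smul, hb, smul_eq_mul]
    rw [Finset.sum_eq_single (r, l)]
    · simp
    · rintro ⟨r', l'⟩ _ hne
      rw [if_neg, mul_zero]
      rintro ⟨h1, h2⟩
      exact hne (Prod.ext h1 (Fin.ext h2))
    · simp
  let F : Q →ₗ[K] (Fin e × Fin (k - c) → K) :=
    (LinearMap.ker q).liftQ Lam hker ∘ₗ (q.quotKerEquivOfSurjective hq).symm.toLinearMap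
  have hF : Function.Surjective F := by
    intro v
    obtain ⟨f, rfl⟩ := hLam v
    refine ⟨q f, ?_⟩
    have : (q.quotKerEquivOfSurjective hq).symm (q f) = (LinearMap.ker q).mkQ f := by
      rw [LinearEquiv.symm_apply_eq]; rfl
    simp [F, this]
  have h := Module.length_le_of_surjective F hF
  rw [Module.length_eq_finrank, Module.finrank_fintype_fun_eq_card] at h
  simp only [Fintype.card_prod, Fintype.card_fin] at h
  calc ((e * k : ℕ) : ℕ∞) ≤ ((e * (k - c) + e * c : ℕ) : ℕ∞) := by
        rw [← mul_add]; exact_mod_cast Nat.mul_le_mul_left _ (by omega)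
    _ = ((e * (k - c) : ℕ) : ℕ∞) + (e * c : ℕ) := by push_cast; rfl
    _ ≤ _ := by gcongr

/-- If every element of `W` is, modulo `J` and `t * W`, a linear combination of the `b j`, then it
is so modulo `J` and `t ^ m * W` for the `t ^ i * b j` with `i < m`. -/
theorem exists_sum_sub_mem {ι : Type*} [Fintype ι] {b : ι → B} {W : Set B}
    (hW : ∀ w ∈ W, ∃ v : ι → K, ∃ w' ∈ W, w - ∑ j, v j • b j - t * w' ∈ J) (m : ℕ) :
    ∀ w ∈ W, ∃ v : Fin m × ι → K, ∃ w' ∈ W,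
      w - ∑ x, v x • (t ^ (x.1 : ℕ) * b x.2) - t ^ m * w' ∈ J := by
  induction m with
  | zero => exact fun w hw => ⟨0, w, hw, by simp⟩
  | succ m ih =>
    intro w hw
    obtain ⟨v, w1, hw1, h1⟩ := ih w hw
    obtain ⟨u, w2, hw2, h2⟩ := hW w1 hw1
    -- The new coefficients `u` form the layer of `t ^ m`, appended after the layers already found.
    refine ⟨fun x => Fin.snoc (α := fun _ => ι → K) (fun i j => v (i, j)) u x.1 x.2, w2, hw2, ?_⟩
    have h3 := J.add_mem h1 (J.mul_mem_left (t ^ m) h2)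
    convert h3 using 1
    rw [Fintype.sum_prod_type, Fin.sum_univ_castSucc, Fintype.sum_prod_type]
    simp only [Fin.snoc_castSucc, Fin.snoc_last, Fin.val_castSucc, Fin.val_last, mul_sub,
      Finset.mul_sum, mul_smul_comm, pow_succ]
    ring

/-- The crude generators `g` are used for only `c` rounds, until the remainder `t ^ c * f'` can be
moved into `W`. From there each power of `t` costs only `e` generators, so the excess is a constant.
-/
theorem length_le_of_generators {e c : ℕ} {ι : Type*} [Fintype ι] (g : ι → B) (b : Fin e → B)
    {W : Set B}
    (hg : ∀ f, ∃ v : ι → K, ∃ f', f - ∑ j, v j • g j - t * f' ∈ J)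
    (hW : ∀ w ∈ W, ∃ v : Fin e → K, ∃ w' ∈ W, w - ∑ j, v j • b j - t * w' ∈ J)
    (hc : ∀ f, ∃ w ∈ W, t ^ c * f - w ∈ J) (k : ℕ) :
    Module.length K ((B ⧸ J) ⧸ Ideal.span {Ideal.Quotient.mk J t ^ k}) ≤
      ((e * k + c * Fintype.card ι : ℕ) : ℕ∞) := by
  set Q := (B ⧸ J) ⧸ Ideal.span {Ideal.Quotient.mk J t ^ k}
  let q : B →ₗ[K] Q := ((Ideal.Quotient.mkₐ K _).comp (Ideal.Quotient.mkₐ K J)).toLinearMap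
  have hq : Function.Surjective q :=
    (Ideal.Quotient.mk_surjective).comp (Ideal.Quotient.mk_surjective)
  let F : ((Fin c × ι) ⊕ (Fin k × Fin e) → K) →ₗ[K] Q :=
    Fintype.linearCombination K (Sum.elim (fun x => q (t ^ (x.1 : ℕ) * g x.2))
      (fun x => q (t ^ (x.1 : ℕ) * b x.2)))
  have hF : Function.Surjective F := by
    intro y
    obtain ⟨f, rfl⟩ := hq y
    obtain ⟨v, f1, -, h1⟩ := exists_sum_sub_mem (W := Set.univ)
      (fun w _ => by simpa using hg w) c f trivial
    obtain ⟨w, hw, h2⟩ := hc f1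
    obtain ⟨u, w2, -, h3⟩ := exists_sum_sub_mem hW k w hw
    refine ⟨Sum.elim v u, ?_⟩
    simp only [F, Fintype.linearCombination_apply, Fintype.sum_sum_type, Sum.elim_inl,
      Sum.elim_inr, ← map_smul, ← map_sum, ← map_add]
    symm
    rw [← sub_eq_zero, ← map_sub]
    refine mk_mk_eq_zero_iff.mpr ⟨w2, ?_⟩
    convert J.add_mem h1 (J.add_mem h2 h3) using 1
    ring
  have h := Module.length_le_of_surjective F hF
  rw [Module.length_eq_finrank K (_ → K), Module.finrank_fintype_fun_eq_card] at h
  simp only [Fintype.card_sum, Fintype.card_prod, Fintype.card_fin] at h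
  refine h.trans (le_of_eq ?_)
  congr 1
  ring

variable [IsNoetherianRing B] [IsLocalRing B]

theorem quotient_multiplicities_of_generators (hJ : J ≤ IsLocalRing.maximalIdeal B)
    (htm : t ∈ IsLocalRing.maximalIdeal B)
    (hres : ∀ f : B, ∃ k : K, f - algebraMap K B k ∈ IsLocalRing.maximalIdeal B) {c₀ : ℕ}
    (hpow : ∀ k, ∀ f ∈ IsLocalRing.maximalIdeal B ^ (k + c₀), ∃ g, f - t ^ k * g ∈ J)
    {ι : Type*} [Fintype ι] (g : ι → B)
    (hg : ∀ f, ∃ v : ι → K, ∃ f', f - ∑ j, v j • g j - t * f' ∈ J)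
    {e c c' : ℕ} (he : 1 ≤ e)
    (lam : Fin e → ℕ → B →ₗ[K] K) (b b' : Fin e → B) (W : Set B)
    (hlam : ∀ r l, ∀ f ∈ J, lam r l f = 0)
    (hlamt : ∀ r l m f, l < m → lam r l (t ^ m * f) = 0)
    (hlamb : ∀ r r' i l, lam r' (c + l) (t ^ i * b r) = if r = r' ∧ i = l then 1 else 0)
    (hW : ∀ w ∈ W, ∃ v : Fin e → K, ∃ w' ∈ W, w - ∑ j, v j • b' j - t * w' ∈ J)
    (hc : ∀ f, ∃ w ∈ W, t ^ c' * f - w ∈ J) {p : ℕ} (hp : 1 < p) :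
    HasHilbertKunzMultiplicity (B ⧸ J) p e ∧ HasMultiplicity (B ⧸ J) e := by
  have hm1 : (1 : B) ∉ IsLocalRing.maximalIdeal B := fun h =>
    (IsLocalRing.maximalIdeal.isMaximal B).ne_top ((Ideal.eq_top_iff_one _).mpr h)
  have : Nontrivial (B ⧸ J) := Ideal.Quotient.nontrivial_iff.mpr fun h =>
    hm1 (hJ (h ▸ Submodule.mem_top))
  have : IsLocalRing (B ⧸ J) :=
    IsLocalRing.of_surjective' (Ideal.Quotient.mk J) Ideal.Quotient.mk_surjective
  have hmk : ∀ f ∈ IsLocalRing.maximalIdeal B,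
      Ideal.Quotient.mk J f ∈ IsLocalRing.maximalIdeal (B ⧸ J) := by
    intro f hf
    rw [IsLocalRing.mem_maximalIdeal, mem_nonunits_iff]
    intro hu
    obtain ⟨a, ha⟩ := hu.exists_right_inv
    obtain ⟨u, rfl⟩ := Ideal.Quotient.mk_surjective a
    rw [← map_mul, ← sub_eq_zero, ← map_one (Ideal.Quotient.mk J), ← map_sub,
      Ideal.Quotient.eq_zero_iff_mem] at ha
    have h1 := Ideal.sub_mem _ (Ideal.mul_mem_right u _ hf) (hJ ha)
    rw [sub_sub_cancel] at h1
    exact hm1 h1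
  have hmap : IsLocalRing.maximalIdeal (B ⧸ J) ≤
      (IsLocalRing.maximalIdeal B).map (Ideal.Quotient.mk J) := by
    intro a ha
    obtain ⟨f, rfl⟩ := Ideal.Quotient.mk_surjective a
    refine Ideal.mem_map_of_mem _ ?_
    by_contra hf
    exact ha ((IsLocalRing.notMem_maximalIdeal.mp hf).map _)
  have hres' : ∀ a : B ⧸ J, ∃ k : K,
      a - algebraMap K (B ⧸ J) k ∈ IsLocalRing.maximalIdeal (B ⧸ J) := by
    intro a
    obtain ⟨f, rfl⟩ := Ideal.Quotient.mk_surjective a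
    obtain ⟨k, hk⟩ := hres f
    exact ⟨k, hmk _ hk⟩
  have hlen := fun k : ℕ => length_eq_length_of_residue hres'
    ((B ⧸ J) ⧸ Ideal.span {Ideal.Quotient.mk J t ^ k})
  refine hasMultiplicity_and_hasHilbertKunzMultiplicity_of_length
    (t := Ideal.Quotient.mk J t) (c := c₀) (e := e) (C := e * c + c' * Fintype.card ι)
    (hmk _ htm) (fun k => ?_) he (fun k => ?_) (fun k => ?_) hp
  · refine (Ideal.pow_right_mono hmap _).trans ?_
    rw [← Ideal.map_pow, Ideal.map_le_iff_le_comap]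
    intro f hf
    obtain ⟨u, hu⟩ := hpow k f hf
    rw [← Ideal.Quotient.eq_zero_iff_mem, map_sub, sub_eq_zero] at hu
    rw [Ideal.mem_comap, hu, map_mul, map_pow]
    exact Ideal.mul_mem_right _ _ (Ideal.mem_span_singleton_self _)
  · rw [hlen]
    refine (le_length_of_dual lam b hlam hlamt hlamb k).trans ?_
    gcongr
    exact_mod_cast Nat.le_add_right _ _
  · rw [hlen]
    refine (length_le_of_generators g b' hg hW hc k).trans ?_
    exact_mod_cast (by omega)

end Bounds

end HilbertKunzExample

namespace HilbertKunzExample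

/-! ### The exponents of the monomials of `R` -/

section Exponents

/-- The exponent vector `(a, b, c)`. -/
noncomputable def expo (a b c : ℕ) : Fin 3 →₀ ℕ := Finsupp.equivFunOnFinite.symm ![a, b, c]

theorem expo_apply (m : Fin 3 →₀ ℕ) : expo (m 0) (m 1) (m 2) = m := by
  ext i; fin_cases i <;> rfl

theorem expo_inj {a b c a' b' c' : ℕ} :
    expo a b c = expo a' b' c' ↔ a = a' ∧ b = b' ∧ c = c' := by
  refine ⟨fun h => ⟨DFunLike.congr_fun h 0, DFunLike.congr_fun h 1, DFunLike.congr_fun h 2⟩, ?_⟩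
  rintro ⟨rfl, rfl, rfl⟩
  rfl

theorem expo_add (a b c a' b' c' : ℕ) :
    expo a b c + expo a' b' c' = expo (a + a') (b + b') (c + c') := by
  ext i; fin_cases i <;> rfl

theorem expo_sub (a b c a' b' c' : ℕ) :
    expo a b c - expo a' b' c' = expo (a - a') (b - b') (c - c') := by
  ext i; fin_cases i <;> rfl

theorem expo_le {a b c a' b' c' : ℕ} :
    expo a b c ≤ expo a' b' c' ↔ a ≤ a' ∧ b ≤ b' ∧ c ≤ c' := by
  refine ⟨fun h => ⟨h 0, h 1, h 2⟩, fun h i => ?_⟩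
  fin_cases i
  exacts [h.1, h.2.1, h.2.2]

theorem expo_zero : expo 0 0 0 = 0 := by
  ext i; fin_cases i <;> rfl

/-- `x ^ a * y ^ b * z ^ c` lies in `R`. -/
def IsExp (a b c : ℕ) : Prop :=
  (a + b + c) % 3 = 0 ∧ ¬ (a = 1 ∧ b % 3 = 2 ∧ c = 0) ∧ ¬ (a = 0 ∧ b = 1 ∧ c % 3 = 2) ∧
    ¬ (a % 3 = 2 ∧ b = 0 ∧ c = 1) ∧ ¬ (a = 1 ∧ b = 1) ∧ ¬ (b = 1 ∧ c = 1) ∧ ¬ (a = 1 ∧ c = 1) ∧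
    ¬ (a = 2 ∧ b = 2 ∧ c = 2)

instance (a b c : ℕ) : Decidable (IsExp a b c) := by
  unfold IsExp
  infer_instance

theorem isExp_of_generators (i j k l m n : ℕ) :
    IsExp (3 * i + 2 * j + n) (j + 3 * k + 2 * l) (l + 3 * m + 2 * n) := by
  refine ⟨by omega, ?_, ?_, ?_, ?_, ?_, ?_, ?_⟩
  · rintro ⟨h1, h2, h3⟩
    obtain rfl : n = 0 := by omega
    omega
  · rintro ⟨h1, h2, h3⟩
    obtain rfl : j = 0 := by omega
    omega
  · rintro ⟨h1, h2, h3⟩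
    obtain rfl : l = 0 := by omega
    omega
  · rintro ⟨h1, h2⟩
    obtain rfl : j = 0 := by omega
    omega
  · rintro ⟨h1, h2⟩
    obtain rfl : l = 0 := by omega
    omega
  · rintro ⟨h1, h2⟩
    obtain rfl : n = 0 := by omega
    omega
  · rintro ⟨h1, h2, h3⟩
    obtain rfl : i = 0 := by omega
    obtain rfl : k = 0 := by omega
    obtain rfl : m = 0 := by omega
    omega

/-- The residues of `a` and `b` modulo 3 determine that of `c`, and each of the nine classes has an
explicit product of generators. Where it would need a negative exponent, a different product is
used, and the excluded families supply the positivity it requires. -/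
theorem IsExp.exists_generators {a b c : ℕ} (h : IsExp a b c) :
    ∃ i j k l m n : ℕ,
      a = 3 * i + 2 * j + n ∧ b = j + 3 * k + 2 * l ∧ c = l + 3 * m + 2 * n := by
  obtain ⟨h0, h1, h2, h3, h4, h5, h6, h7⟩ := h
  obtain ⟨a', ha⟩ : ∃ a', a = 3 * a' ∨ a = 3 * a' + 1 ∨ a = 3 * a' + 2 := ⟨a / 3, by omega⟩
  obtain ⟨b', hb⟩ : ∃ b', b = 3 * b' ∨ b = 3 * b' + 1 ∨ b = 3 * b' + 2 := ⟨b / 3, by omega⟩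
  obtain ⟨c', hc⟩ : ∃ c', c = 3 * c' ∨ c = 3 * c' + 1 ∨ c = 3 * c' + 2 := ⟨c / 3, by omega⟩
  rcases ha with rfl | rfl | rfl <;> rcases hb with rfl | rfl | rfl
  · obtain rfl : c = 3 * c' := by clear h1 h2 h3 h4 h5 h6 h7; omega
    exact ⟨a', 0, b', 0, c', 0, by simp⟩
  · obtain rfl : c = 3 * c' + 2 := by clear h1 h2 h3 h4 h5 h6 h7; omega
    rcases Nat.eq_zero_or_pos a' with rfl | ha
    · have hb : 1 ≤ b' := by clear h1 h3 h4 h5 h6 h7; omega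
      exact ⟨0, 0, b' - 1, 2, c', 0, by omega⟩
    · exact ⟨a' - 1, 1, b', 0, c', 1, by omega⟩
  · obtain rfl : c = 3 * c' + 1 := by clear h1 h2 h3 h4 h5 h6 h7; omega
    exact ⟨a', 0, b', 1, c', 0, by omega⟩
  · obtain rfl : c = 3 * c' + 2 := by clear h1 h2 h3 h4 h5 h6 h7; omega
    exact ⟨a', 0, b', 0, c', 1, by omega⟩
  · obtain rfl : c = 3 * c' + 1 := by clear h1 h2 h3 h4 h5 h6 h7; omega
    rcases Nat.eq_zero_or_pos a' with rfl | ha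
    · have hb : 1 ≤ b' := by clear h1 h2 h3 h5 h6 h7; omega
      have hc : 1 ≤ c' := by clear h1 h2 h3 h4 h5 h7; omega
      exact ⟨0, 0, b' - 1, 2, c' - 1, 1, by omega⟩
    · rcases Nat.eq_zero_or_pos b' with rfl | hb
      · have hc : 1 ≤ c' := by clear h1 h2 h3 h4 h6 h7; omega
        exact ⟨a' - 1, 1, 0, 0, c' - 1, 2, by omega⟩
      · exact ⟨a' - 1, 2, b' - 1, 1, c', 0, by omega⟩
  · obtain rfl : c = 3 * c' := by clear h1 h2 h3 h4 h5 h6 h7; omega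
    rcases Nat.eq_zero_or_pos a' with rfl | ha
    · have hc : 1 ≤ c' := by clear h2 h3 h4 h5 h6 h7; omega
      exact ⟨0, 0, b', 1, c' - 1, 1, by omega⟩
    · exact ⟨a' - 1, 2, b', 0, c', 0, by omega⟩
  · obtain rfl : c = 3 * c' + 1 := by clear h1 h2 h3 h4 h5 h6 h7; omega
    rcases Nat.eq_zero_or_pos b' with rfl | hb
    · have hc : 1 ≤ c' := by clear h1 h2 h4 h5 h6 h7; omega
      exact ⟨a', 0, 0, 0, c' - 1, 2, by omega⟩
    · exact ⟨a', 1, b' - 1, 1, c', 0, by omega⟩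
  · obtain rfl : c = 3 * c' := by clear h1 h2 h3 h4 h5 h6 h7; omega
    exact ⟨a', 1, b', 0, c', 0, by omega⟩
  · obtain rfl : c = 3 * c' + 2 := by clear h1 h2 h3 h4 h5 h6 h7; omega
    rcases Nat.eq_zero_or_pos a' with rfl | ha
    · rcases Nat.eq_zero_or_pos b' with rfl | hb
      · have hc : 1 ≤ c' := by clear h1 h2 h3 h4 h5 h6; omega
        exact ⟨0, 0, 0, 1, c' - 1, 2, by omega⟩
      · exact ⟨0, 1, b' - 1, 2, c', 0, by omega⟩
    · exact ⟨a' - 1, 2, b', 0, c', 1, by omega⟩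

/-- After the subtraction the first exponent is still at least 3. The excluded families that allow
this depend on it only modulo 3 or not at all. -/
theorem IsExp.sub_fst {a b c : ℕ} (h : IsExp a b c) (ha : 6 ≤ a) : IsExp (a - 3) b c := by
  obtain ⟨h0, h1, h2, h3, h4, h5, h6, h7⟩ := h
  exact ⟨by omega, by omega, by omega, by omega, by omega, by omega, by omega, by omega⟩

theorem IsExp.sub_snd {a b c : ℕ} (h : IsExp a b c) (hb : 6 ≤ b) : IsExp a (b - 3) c := by
  obtain ⟨h0, h1, h2, h3, h4, h5, h6, h7⟩ := h
  exact ⟨by omega, by omega, by omega, by omega, by omega, by omega, by omega, by omega⟩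

theorem IsExp.sub_trd {a b c : ℕ} (h : IsExp a b c) (hc : 6 ≤ c) : IsExp a b (c - 3) := by
  obtain ⟨h0, h1, h2, h3, h4, h5, h6, h7⟩ := h
  exact ⟨by omega, by omega, by omega, by omega, by omega, by omega, by omega, by omega⟩

end Exponents

/-! ### Coefficients of the elements of `R` -/

noncomputable section

section Coefficients

variable {K : Type*} [Field K]

open MvPowerSeries in
theorem X_zero_pow (n : ℕ) :
    (X 0 : MvPowerSeries (Fin 3) K) ^ n = monomial (expo n 0 0) 1 := by
  rw [X_pow_eq]; congr 1; congr 1; ext i; fin_cases i <;> simp [expo]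

open MvPowerSeries in
theorem X_one_pow (n : ℕ) :
    (X 1 : MvPowerSeries (Fin 3) K) ^ n = monomial (expo 0 n 0) 1 := by
  rw [X_pow_eq]; congr 1; congr 1; ext i; fin_cases i <;> simp [expo]

open MvPowerSeries in
theorem X_two_pow (n : ℕ) :
    (X 2 : MvPowerSeries (Fin 3) K) ^ n = monomial (expo 0 0 n) 1 := by
  rw [X_pow_eq]; congr 1; congr 1; ext i; fin_cases i <;> simp [expo]

open MvPowerSeries in
theorem gens_prod (e : Fin 6 →₀ ℕ) :
    (e.prod fun s n => gens K s ^ n) = monomial (expo (3 * e 0 + 2 * e 1 + e 5)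
      (e 1 + 3 * e 2 + 2 * e 3) (e 3 + 3 * e 4 + 2 * e 5)) 1 := by
  rw [Finsupp.prod_fintype _ _ (by simp), Fin.prod_univ_six]
  have h0 : gens K 0 = X 0 ^ 3 := rfl
  have h1 : gens K 1 = X 0 ^ 2 * X 1 := rfl
  have h2 : gens K 2 = X 1 ^ 3 := rfl
  have h3 : gens K 3 = X 1 ^ 2 * X 2 := rfl
  have h4 : gens K 4 = X 2 ^ 3 := rfl
  have h5 : gens K 5 = X 2 ^ 2 * X 0 := rfl
  rw [h0, h1, h2, h3, h4, h5]
  simp only [mul_pow, ← pow_mul]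
  simp only [X_zero_pow, X_one_pow, X_two_pow, monomial_mul_monomial, expo_add, mul_one]
  congr 2
  simp only [expo_inj]
  omega

open MvPowerSeries in
theorem coeff_subst_gens (g : MvPowerSeries (Fin 6) K) (m : Fin 3 →₀ ℕ) :
    coeff m (subst (gens K) g) = ∑ᶠ e : Fin 6 →₀ ℕ,
      if m = expo (3 * e 0 + 2 * e 1 + e 5) (e 1 + 3 * e 2 + 2 * e 3) (e 3 + 3 * e 4 + 2 * e 5)
      then coeff e g else 0 := by
  rw [coeff_subst (hasSubst_gens K)]
  congr 1
  ext e
  rw [gens_prod, coeff_monomial, smul_ite, smul_eq_mul, mul_one, smul_zero]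

open MvPowerSeries in
theorem mem_R_iff {f : MvPowerSeries (Fin 3) K} :
    f ∈ R K ↔ ∀ a b c, ¬ IsExp a b c → coeff (expo a b c) f = 0 := by
  constructor
  · rintro ⟨g, rfl⟩ a b c h
    change coeff _ (substAlgHom (hasSubst_gens K) g) = 0
    rw [coe_substAlgHom, coeff_subst_gens]
    refine finsum_eq_zero_of_forall_eq_zero fun e => if_neg fun he => h ?_
    obtain ⟨rfl, rfl, rfl⟩ := expo_inj.mp he
    exact isExp_of_generators _ _ _ _ _ _
  · intro h
    classical
    have hsec : ∀ m : Fin 3 →₀ ℕ, ∃ e : Fin 6 →₀ ℕ, IsExp (m 0) (m 1) (m 2) →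
        m = expo (3 * e 0 + 2 * e 1 + e 5) (e 1 + 3 * e 2 + 2 * e 3)
          (e 3 + 3 * e 4 + 2 * e 5) := by
      intro m
      by_cases hm : IsExp (m 0) (m 1) (m 2)
      · obtain ⟨i, j, k, l, r, n, h0, h1, h2⟩ := hm.exists_generators
        refine ⟨Finsupp.equivFunOnFinite.symm ![i, j, k, l, r, n], fun _ => ?_⟩
        rw [← expo_apply m, h0, h1, h2]
        rfl
      · exact ⟨0, fun h => absurd h hm⟩
    choose s hs using hsec
    let w : (Fin 6 →₀ ℕ) → (Fin 3 →₀ ℕ) := fun e =>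
      expo (3 * e 0 + 2 * e 1 + e 5) (e 1 + 3 * e 2 + 2 * e 3) (e 3 + 3 * e 4 + 2 * e 5)
    -- Different products of generators may give the same monomial. Placing each coefficient on the
    -- single representative chosen by `s` leaves one nonzero term at most in the substitution sum.
    let g : MvPowerSeries (Fin 6) K := fun e => if s (w e) = e then coeff (w e) f else 0
    refine ⟨g, ?_⟩
    change substAlgHom (hasSubst_gens K) g = f
    rw [coe_substAlgHom]
    ext m
    rw [coeff_subst_gens]
    by_cases hm : IsExp (m 0) (m 1) (m 2)
    · rw [finsum_eq_single _ (s m)]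
      · have hw : w (s m) = m := (hs m hm).symm
        rw [if_pos (hs m hm)]
        change (if s (w (s m)) = s m then coeff (w (s m)) f else 0) = _
        rw [hw, if_pos rfl]
      · intro e he
        split_ifs with h1
        · change (if s (w e) = e then coeff (w e) f else 0) = 0
          rw [if_neg]
          rintro h2
          exact he (by rw [← h2]; exact congrArg s h1.symm)
        · rfl
    · have h1 := h _ _ _ hm
      rw [expo_apply] at h1
      rw [h1]
      refine finsum_eq_zero_of_forall_eq_zero fun e => if_neg ?_
      rintro rfl
      exact hm (isExp_of_generators _ _ _ _ _ _)

/-- The coefficient of `x ^ a * y ^ b * z ^ c` on `R`. -/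
def rcoeff (a b c : ℕ) : R K →ₗ[K] K :=
  (MvPowerSeries.coeff (expo a b c)).comp (R K).val.toLinearMap

theorem rcoeff_apply (a b c : ℕ) (f : R K) :
    rcoeff a b c f = MvPowerSeries.coeff (expo a b c) (f : MvPowerSeries (Fin 3) K) := rfl

theorem rcoeff_eq_zero {a b c : ℕ} (h : ¬ IsExp a b c) (f : R K) : rcoeff a b c f = 0 :=
  mem_R_iff.mp f.2 a b c h

theorem rcoeff_ext {f g : R K} (h : ∀ a b c, rcoeff a b c f = rcoeff a b c g) : f = g := by
  apply Subtype.ext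
  ext m
  rw [← expo_apply m]
  exact h _ _ _

/-- The element of `R` with the given coefficients. -/
def ofCoeff (u : ℕ → ℕ → ℕ → K) (hu : ∀ a b c, ¬ IsExp a b c → u a b c = 0) : R K :=
  ⟨fun m => u (m 0) (m 1) (m 2), mem_R_iff.mpr hu⟩

@[simp]
theorem rcoeff_ofCoeff (u : ℕ → ℕ → ℕ → K) (hu : ∀ a b c, ¬ IsExp a b c → u a b c = 0)
    (a b c : ℕ) : rcoeff a b c (ofCoeff u hu) = u a b c := rfl

open Classical in
/-- The monomial `x ^ a * y ^ b * z ^ c` of `R` (zero if it is not in `R`). -/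
def rmonomial (K : Type*) [Field K] (g : ℕ × ℕ × ℕ) : R K :=
  ofCoeff (fun a b c => if g = (a, b, c) ∧ IsExp a b c then 1 else 0)
    fun _ _ _ h => if_neg fun h' => h h'.2

theorem rcoeff_rmonomial {g : ℕ × ℕ × ℕ} (hg : IsExp g.1 g.2.1 g.2.2) (a b c : ℕ) :
    rcoeff a b c (rmonomial K g) = if g = (a, b, c) then 1 else 0 := by
  rw [rmonomial, rcoeff_ofCoeff]
  congr 1
  refine propext ⟨fun h => h.1, ?_⟩
  rintro rfl
  exact ⟨rfl, hg⟩

open MvPowerSeries in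
theorem rcoeff_x3_mul (a b c : ℕ) (f : R K) :
    rcoeff a b c (x3 K * f) = if 3 ≤ a then rcoeff (a - 3) b c f else 0 := by
  have h : ((x3 K : R K) : MvPowerSeries (Fin 3) K) = monomial (expo 3 0 0) 1 :=
    X_zero_pow 3
  rw [rcoeff_apply, MulMemClass.coe_mul, h, coeff_monomial_mul, expo_sub]
  simp [expo_le, rcoeff_apply]

open MvPowerSeries in
theorem rcoeff_y3_mul (a b c : ℕ) (f : R K) :
    rcoeff a b c (y3 K * f) = if 3 ≤ b then rcoeff a (b - 3) c f else 0 := by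
  have h : ((y3 K : R K) : MvPowerSeries (Fin 3) K) = monomial (expo 0 3 0) 1 :=
    X_one_pow 3
  rw [rcoeff_apply, MulMemClass.coe_mul, h, coeff_monomial_mul, expo_sub]
  simp [expo_le, rcoeff_apply]

open MvPowerSeries in
theorem rcoeff_z3_pow_mul (n a b c : ℕ) (f : R K) :
    rcoeff a b c (z3 K ^ n * f) = if 3 * n ≤ c then rcoeff a b (c - 3 * n) f else 0 := by
  have h : ((z3 K ^ n : R K) : MvPowerSeries (Fin 3) K) = monomial (expo 0 0 (3 * n)) 1 := by
    change (X 2 ^ 3) ^ n = _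
    rw [← pow_mul, X_two_pow]
  rw [rcoeff_apply, MulMemClass.coe_mul, h, coeff_monomial_mul, expo_sub]
  simp [expo_le, rcoeff_apply]

theorem rcoeff_z3_mul (a b c : ℕ) (f : R K) :
    rcoeff a b c (z3 K * f) = if 3 ≤ c then rcoeff a b (c - 3) f else 0 := by
  simpa using rcoeff_z3_pow_mul 1 a b c f

/-- The elements of `R` all of whose monomials have exponents in `T`. -/
def supportedIn (K : Type*) [Field K] (T : ℕ → ℕ → ℕ → Prop) : Set (R K) :=
  {f | ∀ a b c, ¬ T a b c → rcoeff a b c f = 0}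

theorem rcoeff_sum_rmonomial {ι : Type*} [Fintype ι] {G : ι → ℕ × ℕ × ℕ}
    (hG : Function.Injective G) (hexp : ∀ j, IsExp (G j).1 (G j).2.1 (G j).2.2)
    (f : R K) (a b c : ℕ) [Decidable (∃ j, G j = (a, b, c))] :
    rcoeff a b c (∑ j, rcoeff (G j).1 (G j).2.1 (G j).2.2 f • rmonomial K (G j)) =
      if ∃ j, G j = (a, b, c) then rcoeff a b c f else 0 := by
  rw [map_sum]
  simp only [map_smul, rcoeff_rmonomial (hexp _)]
  split_ifs with h
  · obtain ⟨j, hj⟩ := h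
    rw [Finset.sum_eq_single j]
    · simp [hj]
    · intro i _ hi
      rw [if_neg fun h => hi (hG (h.trans hj.symm)), smul_zero]
    · simp
  · push Not at h
    exact Finset.sum_eq_zero fun j _ => by rw [if_neg (h j), smul_zero]

/-- If each exponent in `T` is one of the `G j` or lies in `(3, 0, 0) + T₀`, `(0, 3, 0) + T₁` or
`(0, 0, 3) + T₂`, then the elements supported in `T` decompose accordingly. -/
theorem exists_eq_sum_add_of_supportedIn {ι : Type*} [Fintype ι] {G : ι → ℕ × ℕ × ℕ}
    (hG : Function.Injective G) (hexp : ∀ j, IsExp (G j).1 (G j).2.1 (G j).2.2)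
    {T T₀ T₁ T₂ : ℕ → ℕ → ℕ → Prop}
    (h₀ : ∀ a b c, T₀ a b c → IsExp a b c) (h₁ : ∀ a b c, T₁ a b c → IsExp a b c)
    (h₂ : ∀ a b c, T₂ a b c → IsExp a b c)
    (hT : ∀ a b c, T a b c → (∃ j, G j = (a, b, c)) ∨ (3 ≤ a ∧ T₀ (a - 3) b c) ∨
      (3 ≤ b ∧ T₁ a (b - 3) c) ∨ (3 ≤ c ∧ T₂ a b (c - 3)))
    {f : R K} (hf : f ∈ supportedIn K T) :
    ∃ v : ι → K, ∃ f₀ ∈ supportedIn K T₀, ∃ f₁ ∈ supportedIn K T₁, ∃ f₂ ∈ supportedIn K T₂,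
      f = ∑ j, v j • rmonomial K (G j) + (x3 K * f₀ + y3 K * f₁ + z3 K * f₂) := by
  classical
  -- Each monomial is assigned to the first available alternative, in the order `G`, `x³`, `y³`,
  -- `z³`; excluding the earlier alternatives prevents double counting. The indices are shifted by 3
  -- because these are coefficients of the cofactors.
  let u₀ : ℕ → ℕ → ℕ → K := fun a b c =>
    if (¬ ∃ j, G j = (a + 3, b, c)) ∧ T₀ a b c then rcoeff (a + 3) b c f else 0
  let u₁ : ℕ → ℕ → ℕ → K := fun a b c =>
    if (¬ ∃ j, G j = (a, b + 3, c)) ∧ ¬ (3 ≤ a ∧ T₀ (a - 3) (b + 3) c) ∧ T₁ a b c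
    then rcoeff a (b + 3) c f else 0
  let u₂ : ℕ → ℕ → ℕ → K := fun a b c =>
    if (¬ ∃ j, G j = (a, b, c + 3)) ∧ ¬ (3 ≤ a ∧ T₀ (a - 3) b (c + 3)) ∧
      ¬ (3 ≤ b ∧ T₁ a (b - 3) (c + 3)) ∧ T₂ a b c then rcoeff a b (c + 3) f else 0
  refine ⟨fun j => rcoeff (G j).1 (G j).2.1 (G j).2.2 f,
    ofCoeff u₀ fun a b c h => if_neg fun h' => h (h₀ _ _ _ h'.2),
    fun a b c h => if_neg fun h' => h h'.2,
    ofCoeff u₁ fun a b c h => if_neg fun h' => h (h₁ _ _ _ h'.2.2),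
    fun a b c h => if_neg fun h' => h h'.2.2,
    ofCoeff u₂ fun a b c h => if_neg fun h' => h (h₂ _ _ _ h'.2.2.2),
    fun a b c h => if_neg fun h' => h h'.2.2.2, ?_⟩
  refine rcoeff_ext fun a b c => ?_
  rw [map_add, map_add, map_add, rcoeff_sum_rmonomial hG hexp, rcoeff_x3_mul, rcoeff_y3_mul,
    rcoeff_z3_mul, rcoeff_ofCoeff, rcoeff_ofCoeff, rcoeff_ofCoeff]
  have e₀ : (if 3 ≤ a then u₀ (a - 3) b c else 0) =
      if (¬ ∃ j, G j = (a, b, c)) ∧ 3 ≤ a ∧ T₀ (a - 3) b c then rcoeff a b c f else 0 := by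
    by_cases h : 3 ≤ a
    · simp only [u₀, h, if_true, Nat.sub_add_cancel h, true_and]
    · simp [h]
  have e₁ : (if 3 ≤ b then u₁ a (b - 3) c else 0) =
      if (¬ ∃ j, G j = (a, b, c)) ∧ ¬ (3 ≤ a ∧ T₀ (a - 3) b c) ∧ 3 ≤ b ∧ T₁ a (b - 3) c
      then rcoeff a b c f else 0 := by
    by_cases h : 3 ≤ b
    · simp only [u₁, h, if_true, Nat.sub_add_cancel h, true_and]
    · simp [h]
  have e₂ : (if 3 ≤ c then u₂ a b (c - 3) else 0) =
      if (¬ ∃ j, G j = (a, b, c)) ∧ ¬ (3 ≤ a ∧ T₀ (a - 3) b c) ∧ ¬ (3 ≤ b ∧ T₁ a (b - 3) c) ∧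
        3 ≤ c ∧ T₂ a b (c - 3) then rcoeff a b c f else 0 := by
    by_cases h : 3 ≤ c
    · simp only [u₂, h, if_true, Nat.sub_add_cancel h, true_and]
    · simp [h]
  rw [e₀, e₁, e₂]
  by_cases hm : T a b c
  · have := hT a b c hm
    by_cases c1 : ∃ j, G j = (a, b, c) <;> by_cases c2 : 3 ≤ a ∧ T₀ (a - 3) b c <;>
      by_cases c3 : 3 ≤ b ∧ T₁ a (b - 3) c <;> by_cases c4 : 3 ≤ c ∧ T₂ a b (c - 3) <;>
      simp only [c1, c2, c3, c4, if_true, if_false, not_true, not_false_iff, and_true, and_false,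
        add_zero, zero_add, or_self] at this ⊢
  · simp [hf a b c hm]

end Coefficients

/-! ### The maximal ideal of `R` -/

section MaximalIdeal

variable {K : Type*} [Field K]

instance : IsNoetherianRing (R K) :=
  isNoetherianRing_of_surjective _ _
    (MvPowerSeries.substAlgHom (R := K) (hasSubst_gens K)).rangeRestrict.toRingHom
    (AlgHom.rangeRestrict_surjective _)

theorem rcoeff_algebraMap (k : K) : rcoeff 0 0 0 (algebraMap K (R K) k) = k := by
  rw [rcoeff_apply, expo_zero, Subalgebra.coe_algebraMap, MvPowerSeries.algebraMap_apply]
  simp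

theorem mem_maximalIdeal_R {f : R K} :
    f ∈ IsLocalRing.maximalIdeal (R K) ↔ rcoeff 0 0 0 f = 0 := by
  let φ : R K →+* K := MvPowerSeries.constantCoeff.comp (R K).val.toRingHom
  have hφ' : ∀ f, φ f = rcoeff 0 0 0 f := fun f => by rw [rcoeff_apply, expo_zero]; rfl
  have hφ : Function.Surjective φ := fun k => ⟨algebraMap K _ k, by
    rw [hφ', rcoeff_algebraMap]⟩
  have := IsLocalRing.eq_maximalIdeal (RingHom.ker_isMaximal_of_surjective φ hφ)
  rw [← this, RingHom.mem_ker, hφ']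

theorem sub_algebraMap_mem_maximalIdeal (f : R K) :
    f - algebraMap K (R K) (rcoeff 0 0 0 f) ∈ IsLocalRing.maximalIdeal (R K) := by
  rw [mem_maximalIdeal_R, map_sub, rcoeff_algebraMap, sub_self]

/-- Every exponent of `R` has total degree divisible by 3, so elements of the maximal ideal have
order at least 3, and orders add under products. -/
theorem rcoeff_eq_zero_of_mem_pow (k : ℕ) {f : R K} (hf : f ∈ IsLocalRing.maximalIdeal (R K) ^ k)
    {a b c : ℕ} (h : a + b + c < 3 * k) : rcoeff a b c f = 0 := by
  induction k generalizing f a b c with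
  | zero => omega
  | succ k ih =>
    rw [pow_succ] at hf
    refine Submodule.mul_induction_on (C := fun f => rcoeff a b c f = 0) hf ?_ ?_
    · intro g hg u hu
      rw [rcoeff_apply, MulMemClass.coe_mul, MvPowerSeries.coeff_mul]
      refine Finset.sum_eq_zero fun x hx => ?_
      have hx' := Finset.HasAntidiagonal.mem_antidiagonal.mp hx
      rw [← expo_apply x.1, ← expo_apply x.2, expo_add, expo_inj] at hx'
      rw [← expo_apply x.1, ← expo_apply x.2, ← rcoeff_apply, ← rcoeff_apply]
      by_cases h1 : x.1 0 + x.1 1 + x.1 2 < 3 * k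
      · rw [ih hg h1, zero_mul]
      · suffices rcoeff (x.2 0) (x.2 1) (x.2 2) u = 0 by rw [this, mul_zero]
        by_cases h2 : x.2 0 = 0 ∧ x.2 1 = 0 ∧ x.2 2 = 0
        · rw [h2.1, h2.2.1, h2.2.2]
          exact mem_maximalIdeal_R.mp hu
        · refine rcoeff_eq_zero (fun hx2 => ?_) u
          have hx3 := hx2.1
          clear hx2
          omega
    · intro g u hg hu
      rw [map_add, hg, hu, add_zero]

/-- An element of `R` of order at least `18 + 3 * k` is a combination of `x³, y³, z³` with
coefficients of order at least `15 + 3 * k`. -/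
theorem exists_eq_of_order {k : ℕ} {f : R K}
    (hf : ∀ a b c, a + b + c < 18 + 3 * k → rcoeff a b c f = 0) :
    ∃ f₀ f₁ f₂ : R K, (∀ a b c, a + b + c < 15 + 3 * k → rcoeff a b c f₀ = 0) ∧
      (∀ a b c, a + b + c < 15 + 3 * k → rcoeff a b c f₁ = 0) ∧
      (∀ a b c, a + b + c < 15 + 3 * k → rcoeff a b c f₂ = 0) ∧
      f = x3 K * f₀ + y3 K * f₁ + z3 K * f₂ := by
  have hf' : f ∈ supportedIn K fun a b c => IsExp a b c ∧ 18 + 3 * k ≤ a + b + c := by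
    intro a b c h
    by_cases h1 : IsExp a b c
    · exact hf _ _ _ (by simpa [h1] using h)
    · exact rcoeff_eq_zero h1 f
  obtain ⟨v, f₀, h₀, f₁, h₁, f₂, h₂, h⟩ := exists_eq_sum_add_of_supportedIn
    (ι := Empty) (G := fun j => j.elim) (fun j => j.elim) (fun j => j.elim)
    (T₀ := fun a b c => IsExp a b c ∧ 15 + 3 * k ≤ a + b + c)
    (T₁ := fun a b c => IsExp a b c ∧ 15 + 3 * k ≤ a + b + c)
    (T₂ := fun a b c => IsExp a b c ∧ 15 + 3 * k ≤ a + b + c)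
    (fun _ _ _ h => h.1) (fun _ _ _ h => h.1) (fun _ _ _ h => h.1)
    (by
      rintro a b c ⟨h, hk⟩
      right
      -- Total degree at least 18 forces some exponent to be at least 6, where a cube can be split
      -- off without leaving `R`.
      rcases le_or_gt 6 a with ha | ha
      · exact Or.inl ⟨by omega, h.sub_fst ha, by omega⟩
      rcases le_or_gt 6 b with hb | hb
      · exact Or.inr (Or.inl ⟨by omega, h.sub_snd hb, by omega⟩)
      · exact Or.inr (Or.inr ⟨by omega, h.sub_trd (by omega), by omega⟩)) hf'
  refine ⟨f₀, f₁, f₂, fun a b c h => h₀ _ _ _ (by omega), fun a b c h => h₁ _ _ _ (by omega),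
    fun a b c h => h₂ _ _ _ (by omega), ?_⟩
  simpa using h

theorem maximalIdeal_pow_le_span :
    IsLocalRing.maximalIdeal (R K) ^ 6 ≤ Ideal.span {x3 K, y3 K, z3 K} := by
  intro f hf
  obtain ⟨f₀, f₁, f₂, -, -, -, rfl⟩ := exists_eq_of_order (k := 0)
    fun a b c h => rcoeff_eq_zero_of_mem_pow 6 hf (by omega)
  refine Ideal.add_mem _ (Ideal.add_mem _ ?_ ?_) ?_ <;>
    exact Ideal.mul_mem_right _ _ (Ideal.subset_span (by simp))

theorem x3_mem : x3 K ∈ IsLocalRing.maximalIdeal (R K) := by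
  rw [mem_maximalIdeal_R, ← mul_one (x3 K), rcoeff_x3_mul]; rfl

theorem y3_mem : y3 K ∈ IsLocalRing.maximalIdeal (R K) := by
  rw [mem_maximalIdeal_R, ← mul_one (y3 K), rcoeff_y3_mul]; rfl

theorem z3_mem : z3 K ∈ IsLocalRing.maximalIdeal (R K) := by
  rw [mem_maximalIdeal_R, ← mul_one (z3 K), rcoeff_z3_mul]; rfl

end MaximalIdeal

end

end HilbertKunzExample

namespace HilbertKunzExample

noncomputable section

variable {K : Type*} [Field K]

/-! ### The dimension of `R` -/

section Dimension

open MvPowerSeries in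
theorem exists_algHom_kill_X (i : Fin 3) :
    ∃ φ : MvPowerSeries (Fin 3) K →ₐ[K] MvPowerSeries (Fin 3) K,
      φ (X i) = 0 ∧ ∀ j, j ≠ i → φ (X j) = X j := by
  have h : HasSubst (fun j => if j = i then (0 : MvPowerSeries (Fin 3) K) else X j) := by
    apply hasSubst_of_constantCoeff_zero
    intro j
    split_ifs <;> simp
  refine ⟨substAlgHom h, ?_, fun j hj => ?_⟩
  · rw [substAlgHom_X h, if_pos rfl]
  · rw [substAlgHom_X h, if_neg hj]

theorem three_le_krullDim {α : Type*} [Preorder α] {a b c d : α} (h₁ : a < b) (h₂ : b < c)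
    (h₃ : c < d) : ((3 : ℕ) : WithBot ℕ∞) ≤ Order.krullDim α := by
  refine Order.le_krullDim_iff.mpr ⟨⟨3, ![a, b, c, d], fun i => ?_⟩, rfl⟩
  fin_cases i
  exacts [h₁, h₂, h₃]

/-- Krull's height theorem gives dimension at most 3. The kernels of setting `x = 0` and then `y =
0` give primes strictly between zero and the maximal ideal, separated by `x³`, `y³`, `z³`. -/
theorem isSystemOfParameters_x3_y3_z3 : IsSystemOfParameters ![x3 K, y3 K, z3 K] := by
  have hspan : Ideal.span (Set.range ![x3 K, y3 K, z3 K]) = Ideal.span {x3 K, y3 K, z3 K} := by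
    rw [Matrix.range_cons, Matrix.range_cons, Matrix.range_cons, Matrix.range_empty,
      Set.union_empty, Set.insert_eq, Set.insert_eq]
  have hrad : (Ideal.span (Set.range ![x3 K, y3 K, z3 K])).radical =
      IsLocalRing.maximalIdeal (R K) := by
    rw [hspan]
    apply le_antisymm
    · rw [Ideal.IsPrime.radical_le_iff inferInstance, Ideal.span_le]
      rintro _ (rfl | rfl | rfl)
      exacts [x3_mem, y3_mem, z3_mem]
    · exact fun f hf => ⟨6, maximalIdeal_pow_le_span (Ideal.pow_mem_pow hf 6)⟩
  refine ⟨inferInstance, inferInstance, ?_, hrad⟩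
  apply le_antisymm
  · rw [← IsLocalRing.maximalIdeal_height_eq_ringKrullDim]
    have hmin : IsLocalRing.maximalIdeal (R K) ∈
        (Ideal.span (Set.range ![x3 K, y3 K, z3 K])).minimalPrimes := by
      refine ⟨⟨inferInstance, hrad ▸ Ideal.le_radical⟩, fun q hq _ => ?_⟩
      rw [← hrad]
      exact (Ideal.IsPrime.radical_le_iff hq.1).mpr hq.2
    have h1 := Ideal.height_le_card_of_mem_minimalPrimes_span (Set.finite_range _) hmin
    have h2 : (Set.range ![x3 K, y3 K, z3 K]).ncard ≤ 3 := by
      rw [← Nat.card_coe_set_eq]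
      simpa using Finite.card_range_le ![x3 K, y3 K, z3 K]
    have h3 : (IsLocalRing.maximalIdeal (R K)).height ≤ (3 : ℕ) := h1.trans (by exact_mod_cast h2)
    exact WithBot.coe_le_coe.mpr h3
  · obtain ⟨κ₀, hκ₀, hκ₀'⟩ := exists_algHom_kill_X (K := K) 0
    obtain ⟨κ₁, hκ₁, hκ₁'⟩ := exists_algHom_kill_X (K := K) 1
    let φ₁ : R K →+* MvPowerSeries (Fin 3) K := (κ₀.comp (R K).val).toRingHom
    let φ₂ : R K →+* MvPowerSeries (Fin 3) K := κ₁.toRingHom.comp φ₁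
    have hφ₁ : ∀ f : R K, φ₁ f = κ₀ f.1 := fun _ => rfl
    have hφ₂ : ∀ f : R K, φ₂ f = κ₁ (φ₁ f) := fun _ => rfl
    have hx1 : φ₁ (x3 K) = 0 := by
      rw [hφ₁, x3, map_pow, hκ₀, zero_pow (by norm_num)]
    have hy1 : φ₁ (y3 K) = MvPowerSeries.X 1 ^ 3 := by
      rw [hφ₁, y3, map_pow, hκ₀' 1 (by decide)]
    have hz1 : φ₁ (z3 K) = MvPowerSeries.X 2 ^ 3 := by
      rw [hφ₁, z3, map_pow, hκ₀' 2 (by decide)]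
    have hy2 : φ₂ (y3 K) = 0 := by
      rw [hφ₂, hy1, map_pow, hκ₁, zero_pow (by norm_num)]
    have hz2 : φ₂ (z3 K) = MvPowerSeries.X 2 ^ 3 := by
      rw [hφ₂, hz1, map_pow, hκ₁' 2 (by decide)]
    have hX : ∀ i : Fin 3, (MvPowerSeries.X i : MvPowerSeries (Fin 3) K) ^ 3 ≠ 0 := by
      intro i h
      have h1 := congrArg (MvPowerSeries.coeff (Finsupp.single i 3)) h
      rw [MvPowerSeries.X_pow_eq] at h1
      simp at h1
    have hdom : IsDomain (MvPowerSeries (Fin 3) K) := NoZeroDivisors.to_isDomain _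
    have hp1 : (RingHom.ker φ₁).IsPrime := RingHom.ker_isPrime φ₁
    have hp2 : (RingHom.ker φ₂).IsPrime := RingHom.ker_isPrime φ₂
    have l1 : (⟨⊥, Ideal.isPrime_bot⟩ : PrimeSpectrum (R K)) < ⟨RingHom.ker φ₁, hp1⟩ := by
      rw [← PrimeSpectrum.asIdeal_lt_asIdeal]
      refine bot_lt_iff_ne_bot.mpr fun h => hX 0 ?_
      have : x3 K ∈ RingHom.ker φ₁ := hx1
      rw [show RingHom.ker φ₁ = ⊥ from h, Ideal.mem_bot] at this
      exact congrArg Subtype.val this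
    have l2 : (⟨RingHom.ker φ₁, hp1⟩ : PrimeSpectrum (R K)) < ⟨RingHom.ker φ₂, hp2⟩ := by
      rw [← PrimeSpectrum.asIdeal_lt_asIdeal]
      refine SetLike.lt_iff_le_and_exists.mpr ⟨fun f hf => ?_, y3 K, hy2, fun h => hX 1 ?_⟩
      · rw [RingHom.mem_ker, hφ₂, RingHom.mem_ker.mp hf, map_zero]
      · rw [← hy1]; exact h
    have l3 : (⟨RingHom.ker φ₂, hp2⟩ : PrimeSpectrum (R K)) <
        ⟨IsLocalRing.maximalIdeal (R K), inferInstance⟩ := by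
      rw [← PrimeSpectrum.asIdeal_lt_asIdeal]
      refine SetLike.lt_iff_le_and_exists.mpr ⟨IsLocalRing.le_maximalIdeal hp2.ne_top, z3 K,
        z3_mem, fun h => hX 2 ?_⟩
      rw [← hz2]; exact h
    exact three_le_krullDim l1 l2 l3

end Dimension

/-! ### Quotients of `R` by `x³` and a perturbation of `y³` -/

section Quotients

theorem rcoeff_mul_eq_zero {N : ℕ} {f : R K} (hf : ∀ a b c, a + b + c < N → rcoeff a b c f = 0)
    (g : R K) {a b c : ℕ} (h : a + b + c < N) : rcoeff a b c (g * f) = 0 := by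
  rw [rcoeff_apply, MulMemClass.coe_mul, MvPowerSeries.coeff_mul]
  refine Finset.sum_eq_zero fun x hx => ?_
  have hx' := Finset.HasAntidiagonal.mem_antidiagonal.mp hx
  rw [← expo_apply x.1, ← expo_apply x.2, expo_add, expo_inj] at hx'
  rw [← expo_apply x.2, ← rcoeff_apply, hf _ _ _ (by omega), mul_zero]

variable {I : Ideal (R K)} {r : R K}

/-- Modulo `I`, `x³` vanishes and `y³` is a multiple of `z³`, so each cube split off from an element
of high order becomes a factor `z³`. -/
theorem exists_sub_z3_pow_mul_mem (hx : x3 K ∈ I) (hy : y3 K - z3 K * r ∈ I) (k : ℕ) {f : R K}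
    (hf : ∀ a b c, a + b + c < 15 + 3 * k → rcoeff a b c f = 0) :
    ∃ g, f - z3 K ^ k * g ∈ I := by
  induction k generalizing f with
  | zero => exact ⟨f, by simp⟩
  | succ k ih =>
    obtain ⟨f₀, f₁, f₂, -, h₁, h₂, rfl⟩ := exists_eq_of_order (k := k)
      fun a b c h => hf a b c (by omega)
    obtain ⟨g, hg⟩ := ih (f := r * f₁ + f₂) fun a b c h => by
      rw [map_add, rcoeff_mul_eq_zero h₁ r h, h₂ _ _ _ h, add_zero]
    refine ⟨g, ?_⟩
    convert I.add_mem (I.add_mem (I.mul_mem_right f₀ hx) (I.mul_mem_right f₁ hy))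
      (I.mul_mem_left (z3 K) hg) using 1
    ring

/-- Monomials of `R` with some exponent at least 6 are divisible in `R` by one of the three cubes,
so the finitely many with all exponents below 6 generate modulo `I` and `z³`. -/
theorem exists_sub_sum_mem (hx : x3 K ∈ I) (hy : y3 K - z3 K * r ∈ I) (f : R K) :
    ∃ v : {g : Fin 6 × Fin 6 × Fin 6 // IsExp g.1 g.2.1 g.2.2} → K, ∃ f',
      f - ∑ j, v j • rmonomial K ((j.1.1 : ℕ), (j.1.2.1 : ℕ), (j.1.2.2 : ℕ)) - z3 K * f' ∈ I := by
  obtain ⟨v, f₀, -, f₁, -, f₂, -, h⟩ := exists_eq_sum_add_of_supportedIn (K := K)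
    (ι := {g : Fin 6 × Fin 6 × Fin 6 // IsExp g.1 g.2.1 g.2.2})
    (G := fun j => ((j.1.1 : ℕ), (j.1.2.1 : ℕ), (j.1.2.2 : ℕ)))
    (by
      rintro ⟨⟨a, b, c⟩, _⟩ ⟨⟨a', b', c'⟩, _⟩ h
      simp only [Prod.mk.injEq] at h
      simp only [Subtype.mk.injEq, Prod.mk.injEq]
      exact ⟨Fin.ext h.1, Fin.ext h.2.1, Fin.ext h.2.2⟩)
    (fun j => j.2) (T := IsExp) (T₀ := IsExp) (T₁ := IsExp) (T₂ := IsExp)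
    (fun _ _ _ h => h) (fun _ _ _ h => h) (fun _ _ _ h => h)
    (by
      intro a b c h
      rcases le_or_gt 6 a with ha | ha
      · exact Or.inr (Or.inl ⟨by omega, h.sub_fst ha⟩)
      rcases le_or_gt 6 b with hb | hb
      · exact Or.inr (Or.inr (Or.inl ⟨by omega, h.sub_snd hb⟩))
      rcases le_or_gt 6 c with hc | hc
      · exact Or.inr (Or.inr (Or.inr ⟨by omega, h.sub_trd hc⟩))
      · exact Or.inl ⟨⟨(⟨a, ha⟩, ⟨b, hb⟩, ⟨c, hc⟩), h⟩, rfl⟩)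
    (f := f) fun a b c h => rcoeff_eq_zero h f
  refine ⟨v, r * f₁ + f₂, ?_⟩
  convert I.add_mem (I.mul_mem_right f₀ hx) (I.mul_mem_right f₁ hy) using 1
  rw [h]
  ring

theorem quotient_multiplicities (hI : I ≤ IsLocalRing.maximalIdeal (R K))
    (hx : x3 K ∈ I) (hy : y3 K - z3 K * r ∈ I) {e c c' : ℕ} (he : 1 ≤ e)
    (lam : Fin e → ℕ → R K →ₗ[K] K) (b b' : Fin e → R K) (W : Set (R K))
    (hlam : ∀ r l, ∀ f ∈ I, lam r l f = 0)
    (hlamz : ∀ r l m f, l < m → lam r l (z3 K ^ m * f) = 0)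
    (hlamb : ∀ r r' i l,
      lam r' (c + l) (z3 K ^ i * b r) = if r = r' ∧ i = l then 1 else 0)
    (hW : ∀ w ∈ W, ∃ v : Fin e → K, ∃ w' ∈ W, w - ∑ j, v j • b' j - z3 K * w' ∈ I)
    (hc : ∀ f, ∃ w ∈ W, z3 K ^ c' * f - w ∈ I) {p : ℕ} (hp : 1 < p) :
    HasHilbertKunzMultiplicity (R K ⧸ I) p e ∧ HasMultiplicity (R K ⧸ I) e :=
  quotient_multiplicities_of_generators hI z3_mem
    (fun f => ⟨_, sub_algebraMap_mem_maximalIdeal f⟩) (c₀ := 5)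
    (fun k _ hf => exists_sub_z3_pow_mul_mem hx hy k
      fun _ _ _ h => rcoeff_eq_zero_of_mem_pow _ hf (by omega))
    _ (exists_sub_sum_mem hx hy) he lam b b' W hlam hlamz hlamb hW hc hp

end Quotients

end

end HilbertKunzExample

namespace HilbertKunzExample

noncomputable section

variable {K : Type*} [Field K]

/-! ### The quotient by `(x³, y³)` -/

section Monomial

/-- The exponents of free generators over `K⟦z³⟧` of `z³ R / (x³, y³)`. -/
def specialExponents : Fin 11 → ℕ × ℕ × ℕ :=
  ![(0, 0, 3), (2, 1, 3), (0, 2, 4), (1, 0, 5), (1, 2, 6), (0, 4, 5), (3, 1, 5), (2, 0, 7),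
    (1, 4, 7), (4, 1, 7), (2, 2, 8)]

theorem specialExponents_fst_snd_injective {r r' : Fin 11}
    (h : (specialExponents r).1 = (specialExponents r').1)
    (h' : (specialExponents r).2.1 = (specialExponents r').2.1) : r = r' := by
  revert r r'
  decide

theorem IsExp.add_trd {a b c : ℕ} (h : IsExp a b c) : IsExp a b (c + 3) := by
  obtain ⟨h0, h1, h2, h3, h4, h5, h6, h7⟩ := h
  exact ⟨by omega, by omega, by omega, by omega, by omega, by omega, by omega, by omega⟩

theorem isExp_specialExponents (r : Fin 11) (l : ℕ) (hl : 2 ≤ l) :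
    IsExp (specialExponents r).1 (specialExponents r).2.1
      ((specialExponents r).2.2 % 3 + 3 * l) := by
  induction l, hl using Nat.le_induction with
  | base => revert r; decide
  | succ l _ ih => exact ih.add_trd

/-- Dividing by `x³` lands in one of the two missing columns. So the coefficient functionals along
these columns vanish on `x³ R`; the next lemma is the same for `y³ R`. This is where the two extra
generators survive. -/
theorem not_isExp_sub_fst (r : Fin 11) (h : 3 ≤ (specialExponents r).1) (l : ℕ) :
    ¬ IsExp ((specialExponents r).1 - 3) (specialExponents r).2.1
      ((specialExponents r).2.2 % 3 + 3 * l) := by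
  have h1 : (specialExponents r).1 - 3 = 0 ∧ (specialExponents r).2.1 = 1 ∧
      (specialExponents r).2.2 % 3 = 2 ∨
      (specialExponents r).1 - 3 = 1 ∧ (specialExponents r).2.1 = 1 := by
    revert r; decide
  rintro ⟨-, -, h2, -, h4, -⟩
  omega

theorem not_isExp_sub_snd (r : Fin 11) (h : 3 ≤ (specialExponents r).2.1) (l : ℕ) :
    ¬ IsExp (specialExponents r).1 ((specialExponents r).2.1 - 3)
      ((specialExponents r).2.2 % 3 + 3 * l) := by
  have h1 : (specialExponents r).1 = 0 ∧ (specialExponents r).2.1 - 3 = 1 ∧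
      (specialExponents r).2.2 % 3 = 2 ∨
      (specialExponents r).1 = 1 ∧ (specialExponents r).2.1 - 3 = 1 := by
    revert r; decide
  rintro ⟨-, -, h2, -, h4, -⟩
  omega

set_option maxRecDepth 10000 in
theorem specialExponents_or_of_lt : ∀ a b c : Fin 6, IsExp a b c →
    (∃ j, specialExponents j = ((a : ℕ), (b : ℕ), (c : ℕ) + 3)) ∨
      (3 ≤ (a : ℕ) ∧ IsExp (a - 3) b (c + 3)) ∨
      (3 ≤ (b : ℕ) ∧ IsExp a (b - 3) (c + 3)) ∨ (3 ≤ (c : ℕ) ∧ IsExp a b (c - 3)) := by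
  decide

/-- This concerns the monomials of `z³ R`: each is a listed generator or splits off a cube, with
`z³` allowed only if the cofactor is again in `z³ R`. Beyond exponent 6 a cube always splits off,
which leaves a finite check. -/
theorem specialExponents_or {a b c : ℕ} (h : IsExp a b c) :
    (∃ j, specialExponents j = (a, b, c + 3)) ∨ (3 ≤ a ∧ IsExp (a - 3) b (c + 3)) ∨
      (3 ≤ b ∧ IsExp a (b - 3) (c + 3)) ∨ (3 ≤ c ∧ IsExp a b (c - 3)) := by
  rcases le_or_gt 6 a with ha | ha
  · exact Or.inr (Or.inl ⟨by omega, (h.sub_fst ha).add_trd⟩)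
  rcases le_or_gt 6 b with hb | hb
  · exact Or.inr (Or.inr (Or.inl ⟨by omega, (h.sub_snd hb).add_trd⟩))
  rcases le_or_gt 6 c with hc | hc
  · exact Or.inr (Or.inr (Or.inr ⟨by omega, h.sub_trd hc⟩))
  · exact specialExponents_or_of_lt ⟨a, ha⟩ ⟨b, hb⟩ ⟨c, hc⟩ h

theorem multiplicities_quotient_x3_y3 {p : ℕ} (hp : 1 < p) :
    HasHilbertKunzMultiplicity (R K ⧸ Ideal.span {x3 K, y3 K}) p 11 ∧
      HasMultiplicity (R K ⧸ Ideal.span {x3 K, y3 K}) 11 := by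
  have hx : x3 K ∈ Ideal.span {x3 K, y3 K} := Ideal.subset_span (by simp)
  have hy : y3 K ∈ Ideal.span {x3 K, y3 K} := Ideal.subset_span (by simp)
  -- Here `c = 2` because each of the 11 columns lies wholly in `R` from the second power of `z³`
  -- on, and `c' = 1` because `W` is `z³ R`.
  refine quotient_multiplicities (r := 0) (e := 11) (c := 2) (c' := 1) ?_ hx (by simpa using hy)
    (by norm_num)
    (fun r l => rcoeff (specialExponents r).1 (specialExponents r).2.1
      ((specialExponents r).2.2 % 3 + 3 * l))
    (fun r => rmonomial K ((specialExponents r).1, (specialExponents r).2.1,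
      (specialExponents r).2.2 % 3 + 3 * 2))
    (fun r => rmonomial K (specialExponents r))
    (supportedIn K fun a b c => 3 ≤ c ∧ IsExp a b (c - 3)) ?_ ?_ ?_ ?_ ?_ hp
  · rw [Ideal.span_le]
    rintro _ (rfl | rfl)
    exacts [x3_mem, y3_mem]
  · intro r l f hf
    obtain ⟨u, v, rfl⟩ := Ideal.mem_span_pair.mp hf
    rw [map_add, mul_comm u, mul_comm v, rcoeff_x3_mul, rcoeff_y3_mul]
    split_ifs with h1 h2 h2
    · rw [rcoeff_eq_zero (not_isExp_sub_fst r h1 l), rcoeff_eq_zero (not_isExp_sub_snd r h2 l),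
        add_zero]
    · rw [rcoeff_eq_zero (not_isExp_sub_fst r h1 l), add_zero]
    · rw [rcoeff_eq_zero (not_isExp_sub_snd r h2 l), add_zero]
    · rw [add_zero]
  · intro r l m f hlm
    rw [rcoeff_z3_pow_mul, if_neg (by omega)]
  · intro r r' i l
    rw [rcoeff_z3_pow_mul]
    by_cases h : r = r'
    · subst h
      by_cases hil : i = l
      · subst hil
        rw [if_pos (by omega), rcoeff_rmonomial (isExp_specialExponents r 2 le_rfl)]
        simp only [Prod.mk.injEq, true_and, and_true]
        rw [if_pos (by omega), if_true]
      · rw [rcoeff_rmonomial (isExp_specialExponents r 2 le_rfl)]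
        simp only [Prod.mk.injEq, true_and, hil, if_false]
        split_ifs with h1 h2
        · omega
        · rfl
        · rfl
    · rw [rcoeff_rmonomial (isExp_specialExponents r 2 le_rfl)]
      rw [if_neg (c := r = r' ∧ i = l) fun h' => h h'.1]
      split_ifs with h1 h2
      · simp only [Prod.mk.injEq] at h2
        exact absurd (specialExponents_fst_snd_injective h2.1 h2.2.1) h
      · rfl
      · rfl
  · intro w hw
    obtain ⟨v, f₀, -, f₁, -, f₂, h₂, h⟩ := exists_eq_sum_add_of_supportedIn (K := K)
      (G := specialExponents)
      (fun r r' h => specialExponents_fst_snd_injective (by rw [h]) (by rw [h]))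
      (by decide) (T₀ := IsExp) (T₁ := IsExp) (T₂ := fun a b c => 3 ≤ c ∧ IsExp a b (c - 3))
      (fun _ _ _ h => h) (fun _ _ _ h => h)
      (fun a b c h => by
        have := h.2.add_trd
        rwa [Nat.sub_add_cancel h.1] at this)
      (by
        rintro a b c ⟨hc, h⟩
        have h' := specialExponents_or h
        rw [Nat.sub_add_cancel hc] at h'
        refine h'.imp_right (Or.imp_right (Or.imp_right ?_))
        exact fun h'' => ⟨hc, h''⟩) hw
    refine ⟨v, f₂, h₂, ?_⟩
    convert Ideal.add_mem _ (Ideal.mul_mem_right f₀ _ hx) (Ideal.mul_mem_right f₁ _ hy) using 1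
    rw [h]
    ring
  · intro f
    refine ⟨z3 K ^ 1 * f, fun a b c h => ?_, by simp⟩
    rw [rcoeff_z3_pow_mul]
    split_ifs with h1
    · exact rcoeff_eq_zero (fun h2 => h ⟨by omega, h2⟩) f
    · rfl

end Monomial

/-! ### The quotient by `(x³, y³ + z³ⁿ)` -/

section Perturbed

/-- The exponents of free generators of the Veronese ring of degree three over
`K⟦x³, y³, z³⟧`. -/
def veroneseExponents : Fin 9 → ℕ × ℕ × ℕ :=
  ![(0, 0, 0), (2, 1, 0), (0, 2, 1), (1, 0, 2), (1, 2, 0), (0, 1, 2), (2, 0, 1), (1, 1, 1),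
    (2, 2, 2)]

theorem veroneseExponents_injective : Function.Injective veroneseExponents := by
  intro r r'
  revert r r'
  decide

theorem veroneseExponents_lt (r : Fin 9) : (veroneseExponents r).1 < 3 ∧
    (veroneseExponents r).2.1 < 3 ∧ (veroneseExponents r).2.2 < 3 := by
  revert r
  decide

theorem exists_veroneseExponents : ∀ a b c : Fin 3, ((a : ℕ) + b + c) % 3 = 0 →
    ∃ j, veroneseExponents j = ((a : ℕ), (b : ℕ), (c : ℕ)) := by
  decide

/-- Every excluded family forces the second or third exponent below 3. Thus `y³ z³ V` lies in `R`,
and the multiplicity can be computed on this copy of the free module `V`. -/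
theorem isExp_of_three_le {a b c : ℕ} (h : (a + b + c) % 3 = 0) (hb : 3 ≤ b) (hc : 3 ≤ c) :
    IsExp a b c :=
  ⟨h, by omega, by omega, by omega, by omega, by omega, by omega, by omega⟩

theorem isExp_veroneseExponents (r : Fin 9) : IsExp (veroneseExponents r).1
    ((veroneseExponents r).2.1 + 3) ((veroneseExponents r).2.2 + 3) := by
  revert r
  decide

/-- The coefficient of `z ^ (3 * l)`, for the basis `veroneseExponents`, after substituting `0` for
`x³` and `-z³ⁿ` for `y³`. -/
def substCoeff (K : Type*) [Field K] (n : ℕ) (r : Fin 9) (l : ℕ) : R K →ₗ[K] K :=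
  ∑ j ∈ Finset.range (l / n + 1), (-1 : K) ^ j • rcoeff (veroneseExponents r).1
    ((veroneseExponents r).2.1 + 3 * j) ((veroneseExponents r).2.2 + 3 * (l - n * j))

theorem substCoeff_apply (n : ℕ) (r : Fin 9) (l : ℕ) (f : R K) :
    substCoeff K n r l f = ∑ j ∈ Finset.range (l / n + 1), (-1 : K) ^ j *
      rcoeff (veroneseExponents r).1 ((veroneseExponents r).2.1 + 3 * j)
        ((veroneseExponents r).2.2 + 3 * (l - n * j)) f := by
  simp [substCoeff]

theorem substCoeff_x3_mul (n : ℕ) (r : Fin 9) (l : ℕ) (f : R K) :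
    substCoeff K n r l (x3 K * f) = 0 := by
  rw [substCoeff_apply]
  refine Finset.sum_eq_zero fun j _ => ?_
  have := (veroneseExponents_lt r).1
  rw [rcoeff_x3_mul, if_neg (by omega), mul_zero]

theorem substCoeff_z3_pow_mul {n : ℕ} {r : Fin 9} {l m : ℕ} (h : l < m) (f : R K) :
    substCoeff K n r l (z3 K ^ m * f) = 0 := by
  rw [substCoeff_apply]
  refine Finset.sum_eq_zero fun j _ => ?_
  have := (veroneseExponents_lt r).2.2
  have : l - n * j ≤ l := Nat.sub_le _ _
  rw [rcoeff_z3_pow_mul, if_neg (by omega), mul_zero]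

/-- The alternating sums telescope: the term `j + 1` for `y³` cancels the term `j` for `z³ⁿ`. The
first `y³` term and the last `z³ⁿ` term vanish because too few factors of `y` or `z` remain. -/
theorem substCoeff_y3_add_z3_pow_mul {n : ℕ} (hn : 1 ≤ n) (r : Fin 9) (l : ℕ) (f : R K) :
    substCoeff K n r l ((y3 K + z3 K ^ n) * f) = 0 := by
  obtain ⟨-, h1, h2⟩ := veroneseExponents_lt r
  rw [add_mul, map_add, substCoeff_apply, substCoeff_apply, Finset.sum_range_succ',
    Finset.sum_range_succ]
  have e1 : rcoeff (veroneseExponents r).1 ((veroneseExponents r).2.1 + 3 * 0)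
      ((veroneseExponents r).2.2 + 3 * (l - n * 0)) (y3 K * f) = 0 := by
    rw [rcoeff_y3_mul, if_neg (by omega)]
  have e2 : rcoeff (veroneseExponents r).1 ((veroneseExponents r).2.1 + 3 * (l / n))
      ((veroneseExponents r).2.2 + 3 * (l - n * (l / n))) (z3 K ^ n * f) = 0 := by
    have h3 : l - n * (l / n) < n := by
      have := Nat.div_add_mod l n
      have := Nat.mod_lt l hn
      omega
    rw [rcoeff_z3_pow_mul, if_neg (by omega)]
  rw [e1, e2, mul_zero, mul_zero, add_zero, add_zero, ← Finset.sum_add_distrib]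
  refine Finset.sum_eq_zero fun j hj => ?_
  have hj' : n * j + n ≤ l := by
    have h4 : j + 1 ≤ l / n := Finset.mem_range.mp hj
    have := (Nat.le_div_iff_mul_le hn).mp h4
    linarith
  have h5 : n * (j + 1) = n * j + n := by ring
  rw [rcoeff_y3_mul, if_pos (by omega), rcoeff_z3_pow_mul, if_pos (by omega),
    show (veroneseExponents r).2.1 + 3 * (j + 1) - 3 = (veroneseExponents r).2.1 + 3 * j by omega,
    show (veroneseExponents r).2.2 + 3 * (l - n * j) - 3 * n =
      (veroneseExponents r).2.2 + 3 * (l - n * (j + 1)) by omega, pow_succ]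
  ring

/-- The substitution sends `-y³ z³ v` to `z ^ (3 * (n + 1)) * v`, which explains both the sign and
the shift `n + 1`. Only the term `j = 1` sees the factor `y³`. -/
theorem substCoeff_z3_pow_mul_rmonomial {n : ℕ} (hn : 1 ≤ n) (r r' : Fin 9) (i l : ℕ) :
    substCoeff K n r' (n + 1 + l) (z3 K ^ i * -rmonomial K ((veroneseExponents r).1,
      (veroneseExponents r).2.1 + 3, (veroneseExponents r).2.2 + 3)) =
      if r = r' ∧ i = l then 1 else 0 := by
  obtain ⟨h1, h2, h3⟩ := veroneseExponents_lt r
  obtain ⟨h1', h2', h3'⟩ := veroneseExponents_lt r'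
  have hinj : (veroneseExponents r).1 = (veroneseExponents r').1 →
      (veroneseExponents r).2.1 = (veroneseExponents r').2.1 →
      (veroneseExponents r).2.2 = (veroneseExponents r').2.2 → r = r' := fun e1 e2 e3 =>
    veroneseExponents_injective (Prod.ext e1 (Prod.ext e2 e3))
  have hneg : ∀ u v : R K, u * -v = -(u * v) := fun u v => mul_neg u v
  rw [substCoeff_apply, hneg, Finset.sum_eq_single 1]
  · rw [map_neg, rcoeff_z3_pow_mul, rcoeff_rmonomial (isExp_veroneseExponents r),
      show n + 1 + l - n * 1 = 1 + l by omega]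
    simp only [Prod.mk.injEq, mul_one, pow_one, neg_mul, one_mul, neg_neg]
    by_cases h : r = r' ∧ i = l
    · obtain ⟨rfl, rfl⟩ := h
      rw [if_pos (by omega), if_pos ⟨rfl, rfl, by omega⟩, if_pos ⟨rfl, rfl⟩]
    · rw [if_neg h]
      split_ifs with h4 h5
      · have h6 := hinj h5.1 (by omega) (by omega)
        exact absurd ⟨h6, by omega⟩ h
      · rfl
      · rfl
  · intro j _ hj
    rw [map_neg, rcoeff_z3_pow_mul, rcoeff_rmonomial (isExp_veroneseExponents r)]
    simp only [Prod.mk.injEq]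
    split_ifs with h4 h5
    · omega
    · simp
    · simp
  · intro h
    refine absurd (Finset.mem_range.mpr ?_) h
    have : 1 ≤ (n + 1 + l) / n := (Nat.le_div_iff_mul_le hn).mpr (by omega)
    omega

theorem multiplicities_quotient_J {n : ℕ} (hn : 1 ≤ n) {p : ℕ} (hp : 1 < p) :
    HasHilbertKunzMultiplicity (R K ⧸ J K n) p (9 : ℕ) ∧
      HasMultiplicity (R K ⧸ J K n) (9 : ℕ) := by
  have hx : x3 K ∈ J K n := Ideal.subset_span (by simp)
  have hy : y3 K + z3 K ^ n ∈ J K n := Ideal.subset_span (by simp)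
  obtain ⟨k, rfl⟩ : ∃ k, n = k + 1 := ⟨n - 1, by omega⟩
  have hy' : y3 K - z3 K * -z3 K ^ k ∈ J K (k + 1) := by
    convert hy using 1
    ring
  -- With `n = k + 1`, both shifts equal `n + 1`, the power of `z³` to which `y³ z³` is congruent up
  -- to sign. The set `W` is `y³ z³ V`.
  refine quotient_multiplicities (c := k + 1 + 1) (c' := k + 1 + 1) ?_ hx hy' (by norm_num)
    (substCoeff K (k + 1))
    (fun r => -rmonomial K ((veroneseExponents r).1,
      (veroneseExponents r).2.1 + 3, (veroneseExponents r).2.2 + 3))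
    (fun r => rmonomial K ((veroneseExponents r).1,
      (veroneseExponents r).2.1 + 3, (veroneseExponents r).2.2 + 3))
    (supportedIn K fun a b c => (a + b + c) % 3 = 0 ∧ 3 ≤ b ∧ 3 ≤ c) ?_
    (fun r l m f h => substCoeff_z3_pow_mul h f)
    (substCoeff_z3_pow_mul_rmonomial hn) ?_ ?_ hp
  · rw [J, Ideal.span_le]
    rintro _ (rfl | rfl)
    exacts [x3_mem, Ideal.add_mem _ y3_mem (Ideal.pow_mem_of_mem _ z3_mem _ hn)]
  · intro r l f hf
    obtain ⟨u, v, rfl⟩ := Ideal.mem_span_pair.mp hf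
    rw [map_add, mul_comm u, mul_comm v, substCoeff_x3_mul, substCoeff_y3_add_z3_pow_mul hn,
      add_zero]
  · intro w hw
    obtain ⟨v, f₀, -, f₁, h₁, f₂, h₂, h⟩ := exists_eq_sum_add_of_supportedIn (K := K)
      (G := fun r => ((veroneseExponents r).1,
        (veroneseExponents r).2.1 + 3, (veroneseExponents r).2.2 + 3))
      (fun r r' h => veroneseExponents_injective (by
        simp only [Prod.mk.injEq] at h
        exact Prod.ext h.1 (Prod.ext (by omega) (by omega))))
      isExp_veroneseExponents
      (T₀ := fun a b c => (a + b + c) % 3 = 0 ∧ 3 ≤ b ∧ 3 ≤ c)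
      (T₁ := fun a b c => (a + b + c) % 3 = 0 ∧ 3 ≤ b ∧ 3 ≤ c)
      (T₂ := fun a b c => (a + b + c) % 3 = 0 ∧ 3 ≤ b ∧ 3 ≤ c)
      (fun _ _ _ h => isExp_of_three_le h.1 h.2.1 h.2.2)
      (fun _ _ _ h => isExp_of_three_le h.1 h.2.1 h.2.2)
      (fun _ _ _ h => isExp_of_three_le h.1 h.2.1 h.2.2)
      (by
        rintro a b c ⟨h, hb, hc⟩
        by_cases ha' : 3 ≤ a
        · right; left; omega
        by_cases hb' : 6 ≤ b
        · right; right; left; omega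
        by_cases hc' : 6 ≤ c
        · right; right; right; omega
        left
        obtain ⟨j, hj⟩ := exists_veroneseExponents ⟨a, by omega⟩ ⟨b - 3, by omega⟩ ⟨c - 3, by omega⟩
          (by simp only; omega)
        refine ⟨j, ?_⟩
        rw [hj]
        simp only [Nat.sub_add_cancel hb, Nat.sub_add_cancel hc]) hw
    -- Modulo `J`, `y³ f₁` equals `-z³ (z³ᵏ f₁)`, so it joins the `z³` part of the remainder.
    refine ⟨v, -(z3 K ^ k * f₁) + f₂, fun a b c h' => ?_, ?_⟩
    · rw [map_add, map_neg, rcoeff_z3_pow_mul, h₂ _ _ _ h', add_zero]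
      split_ifs with h3
      · rw [h₁ _ _ _ (by omega), neg_zero]
      · exact neg_zero
    · convert Ideal.add_mem _ (Ideal.mul_mem_right f₀ _ hx) (Ideal.mul_mem_right f₁ _ hy) using 1
      rw [h]
      ring
  · intro f
    -- The difference from `z ^ (3 * (n + 1)) * f` is `z³ f (y³ + z³ⁿ)`, which lies in `J`.
    refine ⟨-(y3 K * (z3 K ^ 1 * f)), fun a b c h => ?_, ?_⟩
    · rw [map_neg, rcoeff_y3_mul, rcoeff_z3_pow_mul]
      split_ifs with h1 h2
      · rw [rcoeff_eq_zero (fun h3 => h ?_), neg_zero]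
        have := h3.1
        clear h3
        omega
      · exact neg_zero
      · exact neg_zero
    · convert Ideal.mul_mem_left _ (z3 K * f) hy using 1
      ring

end Perturbed

end

end HilbertKunzExample

theorem mainTheorem8 (p : ℕ) [Fact p.Prime] (K : Type*) [Field K] [CharP K p] :
    HilbertKunzExample.IsSystemOfParameters
      ![HilbertKunzExample.x3 K, HilbertKunzExample.y3 K, HilbertKunzExample.z3 K] ∧
    (HilbertKunzExample.HasHilbertKunzMultiplicity
        (HilbertKunzExample.R K ⧸
          Ideal.span {HilbertKunzExample.x3 K, HilbertKunzExample.y3 K}) p 11 ∧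
      HilbertKunzExample.HasMultiplicity
        (HilbertKunzExample.R K ⧸
          Ideal.span {HilbertKunzExample.x3 K, HilbertKunzExample.y3 K}) 11) ∧
    (∀ n : ℕ, 1 ≤ n → ¬ n ≡ 1 [MOD 3] →
      ∃ e : ℕ, e ≠ 11 ∧
        HilbertKunzExample.HasHilbertKunzMultiplicity
          (HilbertKunzExample.R K ⧸ HilbertKunzExample.J K n) p (e : ℝ) ∧
        HilbertKunzExample.HasMultiplicity
          (HilbertKunzExample.R K ⧸ HilbertKunzExample.J K n) (e : ℝ)) ∧
    (∃ δ : ℝ, 0 < δ ∧ ∀ N : ℕ,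
      ∃ ε₁ ∈ IsLocalRing.maximalIdeal (HilbertKunzExample.R K) ^ N,
      ∃ ε₂ ∈ IsLocalRing.maximalIdeal (HilbertKunzExample.R K) ^ N,
      ∃ e : ℝ, δ ≤ |e - 11| ∧
        HilbertKunzExample.HasHilbertKunzMultiplicity
          (HilbertKunzExample.R K ⧸
            Ideal.span {HilbertKunzExample.x3 K + ε₁, HilbertKunzExample.y3 K + ε₂}) p e ∧
        HilbertKunzExample.HasMultiplicity
          (HilbertKunzExample.R K ⧸
            Ideal.span {HilbertKunzExample.x3 K + ε₁, HilbertKunzExample.y3 K + ε₂}) e) := by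
  have hp : 1 < p := (Fact.out : p.Prime).one_lt
  refine ⟨HilbertKunzExample.isSystemOfParameters_x3_y3_z3,
    HilbertKunzExample.multiplicities_quotient_x3_y3 hp,
    fun n hn _ => ⟨9, by norm_num, HilbertKunzExample.multiplicities_quotient_J hn hp⟩,
    -- The gap is `11 - 9 = 2`. Perturbing by `z ^ (3 * (N + 1))` gives the ideal `J` with index `N
    -- + 1`, which is positive even for `N = 0`.
    2, by norm_num, fun N => ⟨0, Submodule.zero_mem _, HilbertKunzExample.z3 K ^ (N + 1),
      Ideal.pow_le_pow_right (Nat.le_succ N)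
        (Ideal.pow_mem_pow HilbertKunzExample.z3_mem (N + 1)), (9 : ℕ), ?_, ?_⟩⟩
  · norm_num [abs_of_neg]
  · rw [add_zero]
    exact HilbertKunzExample.multiplicities_quotient_J (Nat.le_add_left 1 N) hp
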